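/- Let $L_2[0,1]$ and $L_2([0,1]^2)$ be the complex Hilbert spaces with respect to Lebesgue measure. Let $u,v$ be non-negative continuous real functions on $[0,1]$, each of which vanishes at some point, and which are not both identically zero. Let $k_1,k_2$ be continuous complex functions on $[0,1]^2$ with $k_i(x,s)=\overline{k_i(s,x)}$, and suppose that the integral operators $(K_i\varphi)(x)=\int_0^1 k_i(x,s)\varphi(s)\,ds$ on $L_2[0,1]$ satisfy $K_1\ge 0$ and $K_2\ge 0$. Consider the Friedrichs models $$(H_1\varphi)(x)=u(x)\varphi(x)-(K_1\varphi)(x),\qquad (H_2\varphi)(x)=v(x)\varphi(x)-(K_2\varphi)(x)$$ on $L_2[0,1]$, and the "three-particle" operator $T$ on $L_2([0,1]^2)$ (that is, $T=H_1\otimes E+E\otimes H_2$): $$(Tf)(x,y)=(u(x)+v(y))f(x,y)-\int_0^1 k_1(x,s)f(s,y)\,ds-\int_0^1 k_2(y,t)f(x,t)\,dt .$$ For a bounded self-adjoint operator $A$, let $\sigma_d(A)$ be the set of eigenvalues of finite multiplicity that are isolated points of $\sigma(A)$, and $\sigma_e(A)=\sigma(A)\setminus\sigma_d(A)$. One says that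 $A$ has the Efimov effect from the left at $\lambda\in\sigma_e(A)$ if $(\lambda-\delta,\lambda]\cap\sigma_e(A)=\{\lambda\}$ for some $\delta>0$ and there is a sequence of eigenvalues $\lambda_n<\lambda$ of $A$ with $\lambda_n\to\lambda$. Suppose that $\sigma_d(H_1)$ and $\sigma_d(H_2)$ are both infinite (equivalently, $H_1$ and $H_2$ both have infinitely many negative eigenvalues). Then $\sigma_e(T)$ is a finite union of closed segments $$\sigma_e(T)=\bigcup_{k=1}^{n}[S_k,S_k'],\qquad S_k\le S_k'<S_{k+1},$$ with $S_k<S_k'$ for all $k$ if neither $u$ nor $v$ is identically zero, and $T$ has the Efimov effect from the left at every point $S_1,\dots,S_n$. -/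

import Mathlib

open MeasureTheory Set Filter Topology
open scoped unitInterval ENNReal ComplexConjugate

/-- The complex Hilbert space `L₂[0,1]` (Lebesgue measure). -/
abbrev L2I : Type := Lp ℂ 2 (volume : Measure I)

/-- The complex Hilbert space `L₂([0,1]²)` (Lebesgue measure). -/
abbrev L2Sq : Type := Lp ℂ 2 (volume : Measure (I × I))

noncomputable section

/-! ### Multiplication operators and integration in one variable on `L₂` -/

section Operators

variable {X Y : Type*} [MeasureSpace X] [MeasureSpace Y]

theorem memLp_continuous_mul [TopologicalSpace X] [CompactSpace X] [OpensMeasurableSpace X]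
    (g : C(X, ℂ)) (f : Lp ℂ 2 (volume : Measure X)) :
    MemLp (fun x => g x * f x) 2 volume := by
  refine (Lp.memLp f).of_le_mul (c := ‖g‖) ?_ ?_
  · exact (g.continuous.measurable.aestronglyMeasurable).mul (Lp.aestronglyMeasurable f)
  · refine Eventually.of_forall fun x => ?_
    rw [norm_mul]
    exact mul_le_mul_of_nonneg_right (g.norm_coe_le_norm x) (norm_nonneg _)

/-- Multiplication by a continuous function `g`, as a bounded operator on `L₂`. -/
def mulOp [TopologicalSpace X] [CompactSpace X] [OpensMeasurableSpace X]
    (g : C(X, ℂ)) : Lp ℂ 2 (volume : Measure X) →L[ℂ] Lp ℂ 2 (volume : Measure X) :=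
  LinearMap.mkContinuous
    { toFun := fun f => (memLp_continuous_mul g f).toLp _
      map_add' := fun f₁ f₂ => by
        apply Lp.ext
        filter_upwards [MemLp.coeFn_toLp (memLp_continuous_mul g (f₁ + f₂)),
          MemLp.coeFn_toLp (memLp_continuous_mul g f₁),
          MemLp.coeFn_toLp (memLp_continuous_mul g f₂), Lp.coeFn_add f₁ f₂,
          Lp.coeFn_add ((memLp_continuous_mul g f₁).toLp _)
            ((memLp_continuous_mul g f₂).toLp _)] with x h1 h2 h3 h4 h5
        rw [h1, h5, Pi.add_apply, h2, h3, h4, Pi.add_apply, mul_add]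
      map_smul' := fun c f => by
        apply Lp.ext
        filter_upwards [MemLp.coeFn_toLp (memLp_continuous_mul g (c • f)),
          MemLp.coeFn_toLp (memLp_continuous_mul g f), Lp.coeFn_smul c f,
          Lp.coeFn_smul c ((memLp_continuous_mul g f).toLp _)] with x h1 h2 h3 h4
        simp only [RingHom.id_apply]
        rw [h1, h4, Pi.smul_apply, h2, h3, Pi.smul_apply, smul_eq_mul, smul_eq_mul]
        ring }
    ‖g‖ (fun f => by
      refine Lp.norm_le_mul_norm_of_ae_le_mul ?_
      filter_upwards [MemLp.coeFn_toLp (memLp_continuous_mul g f)] with x h1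
      simp only [LinearMap.coe_mk, AddHom.coe_mk]
      rw [h1, norm_mul]
      exact mul_le_mul_of_nonneg_right (g.norm_coe_le_norm x) (norm_nonneg _))

theorem mulOp_ae [TopologicalSpace X] [CompactSpace X] [OpensMeasurableSpace X]
    (g : C(X, ℂ)) (f : Lp ℂ 2 (volume : Measure X)) :
    mulOp g f =ᵐ[volume] fun x => g x * f x :=
  MemLp.coeFn_toLp (memLp_continuous_mul g f)

variable [IsProbabilityMeasure (volume : Measure X)] [IsProbabilityMeasure (volume : Measure Y)]

set_option linter.unusedSectionVars false

theorem eLpNorm_marginal_le (F : Lp ℂ 2 (volume : Measure (X × Y))) :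
    eLpNorm (fun x => ∫ y, F (x, y)) 2 (volume : Measure X) ≤ eLpNorm F 2 volume := by
  have hF := Lp.stronglyMeasurable F
  have key : ∀ x : X, ‖∫ y, F (x, y)‖ₑ ^ (2 : ℝ) ≤ ∫⁻ y, ‖F (x, y)‖ₑ ^ (2 : ℝ) := by
    intro x
    have hx : AEStronglyMeasurable (fun y => F (x, y)) (volume : Measure Y) :=
      (hF.comp_measurable measurable_prodMk_left).aestronglyMeasurable
    have h1 : ‖∫ y, F (x, y)‖ₑ ≤ eLpNorm (fun y => F (x, y)) 1 (volume : Measure Y) := by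
      rw [eLpNorm_one_eq_lintegral_enorm]
      exact enorm_integral_le_lintegral_enorm _
    have h2 : eLpNorm (fun y => F (x, y)) 1 (volume : Measure Y) ≤
        eLpNorm (fun y => F (x, y)) 2 (volume : Measure Y) :=
      eLpNorm_le_eLpNorm_of_exponent_le (by norm_num) hx
    have h3 := ENNReal.rpow_le_rpow (h1.trans h2) (by norm_num : (0 : ℝ) ≤ 2)
    refine h3.trans (le_of_eq ?_)
    rw [eLpNorm_eq_lintegral_rpow_enorm_toReal (by norm_num) (by norm_num),
      ← ENNReal.rpow_mul]
    norm_num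
  rw [eLpNorm_eq_lintegral_rpow_enorm_toReal (by norm_num) (by norm_num),
    eLpNorm_eq_lintegral_rpow_enorm_toReal (by norm_num) (by norm_num)]
  refine ENNReal.rpow_le_rpow ?_ (by norm_num)
  have hm : Measurable fun p : X × Y => ‖F p‖ₑ ^ (2 : ℝ) :=
    (hF.measurable.enorm).pow_const _
  have h4 : ∫⁻ p : X × Y, ‖F p‖ₑ ^ (2 : ℝ) = ∫⁻ x : X, ∫⁻ y : Y, ‖F (x, y)‖ₑ ^ (2 : ℝ) :=
    lintegral_prod _ hm.aemeasurable
  simp only [ENNReal.toReal_ofNat]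
  rw [h4]
  exact lintegral_mono key

theorem memLp_marginal (F : Lp ℂ 2 (volume : Measure (X × Y))) :
    MemLp (fun x => ∫ y, F (x, y)) 2 (volume : Measure X) :=
  ⟨((Lp.stronglyMeasurable F).integral_prod_right' (ν := (volume : Measure Y))).aestronglyMeasurable,
    (eLpNorm_marginal_le F).trans_lt (Lp.memLp F).2⟩

/-- Integration in the second variable, `F ↦ (x ↦ ∫ F(x,y) dy)`, as a bounded operator from
`L₂(X × Y)` to `L₂(X)`, for probability spaces `X` and `Y`. -/
def marginalOp :
    Lp ℂ 2 (volume : Measure (X × Y)) →L[ℂ] Lp ℂ 2 (volume : Measure X) :=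
  LinearMap.mkContinuous
    { toFun := fun F => (memLp_marginal F).toLp _
      map_add' := fun F G => by
        have hF := ((Lp.memLp F).integrable (by norm_num)).prod_right_ae
        have hG := ((Lp.memLp G).integrable (by norm_num)).prod_right_ae
        apply Lp.ext
        filter_upwards [MemLp.coeFn_toLp (memLp_marginal (F + G)),
          MemLp.coeFn_toLp (memLp_marginal F), MemLp.coeFn_toLp (memLp_marginal G),
          Lp.coeFn_add ((memLp_marginal F).toLp _) ((memLp_marginal G).toLp _),
          Measure.ae_ae_of_ae_prod (Lp.coeFn_add F G), hF, hG] with x h1 h2 h3 h4 h5 h6 h7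
        rw [h1, h4, Pi.add_apply, h2, h3, integral_congr_ae h5]
        exact integral_add h6 h7
      map_smul' := fun c F => by
        apply Lp.ext
        filter_upwards [MemLp.coeFn_toLp (memLp_marginal (c • F)),
          MemLp.coeFn_toLp (memLp_marginal F),
          Lp.coeFn_smul c ((memLp_marginal F).toLp _),
          Measure.ae_ae_of_ae_prod (Lp.coeFn_smul c F)] with x h1 h2 h3 h4
        simp only [RingHom.id_apply]
        rw [h1, h3, Pi.smul_apply, h2, integral_congr_ae h4]
        exact integral_smul c _ }
    1 (fun F => by
      simp only [LinearMap.coe_mk, AddHom.coe_mk]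
      rw [one_mul, Lp.norm_toLp, Lp.norm_def]
      exact ENNReal.toReal_mono (Lp.memLp F).2.ne (eLpNorm_marginal_le F))

theorem marginalOp_ae (F : Lp ℂ 2 (volume : Measure (X × Y))) :
    marginalOp F =ᵐ[volume] fun x => ∫ y, F (x, y) :=
  MemLp.coeFn_toLp (memLp_marginal F)

/-- The bounded operator `f ↦ (x ↦ ∫ g(x,s) f(e(x,s)) ds)` on `L₂(X)`, for a continuous `g` and a
measure preserving map `e : X × Y → X`. -/
def kernelOp [TopologicalSpace X] [CompactSpace X] [TopologicalSpace Y] [CompactSpace Y]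
    [OpensMeasurableSpace (X × Y)] (g : C(X × Y, ℂ)) (e : X × Y → X)
    (he : MeasurePreserving e (volume : Measure (X × Y)) (volume : Measure X)) :
    Lp ℂ 2 (volume : Measure X) →L[ℂ] Lp ℂ 2 (volume : Measure X) :=
  marginalOp ∘L mulOp g ∘L
    (Lp.compMeasurePreservingₗᵢ ℂ e he).toContinuousLinearMap

theorem kernelOp_ae [TopologicalSpace X] [CompactSpace X] [TopologicalSpace Y] [CompactSpace Y]
    [OpensMeasurableSpace (X × Y)] (g : C(X × Y, ℂ)) (e : X × Y → X)
    (he : MeasurePreserving e (volume : Measure (X × Y)) (volume : Measure X))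
    (f : Lp ℂ 2 (volume : Measure X)) :
    kernelOp g e he f =ᵐ[volume] fun x => ∫ s, g (x, s) * f (e (x, s)) := by
  have h2 : (mulOp g (Lp.compMeasurePreserving e he f) : X × Y → ℂ) =ᵐ[volume]
      fun p => g p * f (e p) := by
    filter_upwards [mulOp_ae g (Lp.compMeasurePreserving e he f),
      Lp.coeFn_compMeasurePreserving f he] with p h3 h4
    rw [h3, h4, Function.comp_apply]
  filter_upwards [marginalOp_ae (mulOp g (Lp.compMeasurePreserving e he f)),
    Measure.ae_ae_of_ae_prod h2] with x h3 h4
  exact h3.trans (integral_congr_ae h4)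

end Operators

/-! ### The operators of the model -/

/-- A real continuous function regarded as a complex one. -/
def toComplexMap {X : Type*} [TopologicalSpace X] (u : C(X, ℝ)) : C(X, ℂ) :=
  ⟨fun x => (u x : ℂ), Complex.continuous_ofReal.comp u.continuous⟩

theorem measurePreserving_slice₁ :
    MeasurePreserving (fun q : (I × I) × I => (q.2, q.1.2)) volume volume :=
  (MeasurePreserving.prod (μa := (volume : Measure I)) (μc := (volume : Measure (I × I)))
      (MeasurePreserving.id (volume : Measure I))
      (measurePreserving_snd (μ := (volume : Measure I)) (ν := (volume : Measure I)))).comp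
    (Measure.measurePreserving_swap (μ := (volume : Measure (I × I)))
      (ν := (volume : Measure I)))

theorem measurePreserving_slice₂ :
    MeasurePreserving (fun q : (I × I) × I => (q.1.1, q.2)) volume volume :=
  MeasurePreserving.prod (μa := (volume : Measure (I × I))) (μc := (volume : Measure I))
    measurePreserving_fst (MeasurePreserving.id (volume : Measure I))

/-- The integral operator `(K φ)(x) = ∫ k(x,s) φ(s) ds` on `L₂[0,1]`. -/
def integralOp (k : C(I × I, ℂ)) : L2I →L[ℂ] L2I :=
  kernelOp k Prod.snd measurePreserving_snd

theorem integralOp_ae (k : C(I × I, ℂ)) (φ : L2I) :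
    integralOp k φ =ᵐ[volume] fun x => ∫ s, k (x, s) * φ s :=
  kernelOp_ae k Prod.snd measurePreserving_snd φ

/-- The Friedrichs model `(H φ)(x) = u(x) φ(x) - ∫ k(x,s) φ(s) ds` on `L₂[0,1]`. -/
def friedrichs (u : C(I, ℝ)) (k : C(I × I, ℂ)) : L2I →L[ℂ] L2I :=
  mulOp (toComplexMap u) - integralOp k

theorem friedrichs_ae (u : C(I, ℝ)) (k : C(I × I, ℂ)) (φ : L2I) :
    friedrichs u k φ =ᵐ[volume] fun x => (u x : ℂ) * φ x - ∫ s, k (x, s) * φ s := by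
  filter_upwards [Lp.coeFn_sub (mulOp (toComplexMap u) φ) (integralOp k φ),
    mulOp_ae (toComplexMap u) φ, integralOp_ae k φ] with x h1 h2 h3
  have h4 : (friedrichs u k φ : I → ℂ) x =
    (mulOp (toComplexMap u) φ - integralOp k φ : L2I) x := rfl
  rw [h4, h1, Pi.sub_apply, h2, h3]
  rfl

/-- `(T₀ f)(x,y) = (u(x) + v(y)) f(x,y)`. -/
def opT₀ (u v : C(I, ℝ)) : L2Sq →L[ℂ] L2Sq :=
  mulOp (toComplexMap (u.comp ContinuousMap.fst + v.comp ContinuousMap.snd))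

/-- `(T₁ f)(x,y) = ∫∫ k₁(x,s) δ(y-t) f(s,t) ds dt = ∫ k₁(x,s) f(s,y) ds`. -/
def opT₁ (k₁ : C(I × I, ℂ)) : L2Sq →L[ℂ] L2Sq :=
  kernelOp (k₁.comp ⟨fun q : (I × I) × I => (q.1.1, q.2), by fun_prop⟩)
    (fun q => (q.2, q.1.2)) measurePreserving_slice₁

/-- `(T₂ f)(x,y) = ∫∫ k₂(y,t) δ(x-s) f(s,t) ds dt = ∫ k₂(y,t) f(x,t) dt`. -/
def opT₂ (k₂ : C(I × I, ℂ)) : L2Sq →L[ℂ] L2Sq :=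
  kernelOp (k₂.comp ⟨fun q : (I × I) × I => (q.1.2, q.2), by fun_prop⟩)
    (fun q => (q.1.1, q.2)) measurePreserving_slice₂

/-- The "three-particle" operator `T = T₀ - (T₁ + T₂)` on `L₂([0,1]²)`. -/
def opT (u v : C(I, ℝ)) (k₁ k₂ : C(I × I, ℂ)) : L2Sq →L[ℂ] L2Sq :=
  opT₀ u v - (opT₁ k₁ + opT₂ k₂)

theorem opT_ae (u v : C(I, ℝ)) (k₁ k₂ : C(I × I, ℂ)) (f : L2Sq) :
    opT u v k₁ k₂ f =ᵐ[volume] fun p =>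
      ((u p.1 : ℂ) + (v p.2 : ℂ)) * f p -
        ((∫ s, k₁ (p.1, s) * f (s, p.2)) + ∫ t, k₂ (p.2, t) * f (p.1, t)) := by
  have h1 : (opT₁ k₁ f : I × I → ℂ) =ᵐ[volume] fun p => ∫ s, k₁ (p.1, s) * f (s, p.2) :=
    kernelOp_ae _ _ measurePreserving_slice₁ f
  have h2 : (opT₂ k₂ f : I × I → ℂ) =ᵐ[volume] fun p => ∫ t, k₂ (p.2, t) * f (p.1, t) :=
    kernelOp_ae _ _ measurePreserving_slice₂ f
  have h0 : (opT₀ u v f : I × I → ℂ) =ᵐ[volume]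
      fun p => ((u p.1 + v p.2 : ℝ) : ℂ) * f p := mulOp_ae _ f
  filter_upwards [Lp.coeFn_sub (opT₀ u v f) (opT₁ k₁ f + opT₂ k₂ f),
    Lp.coeFn_add (opT₁ k₁ f) (opT₂ k₂ f), h0, h1, h2] with p g1 g2 g3 g4 g5
  have g6 : (opT u v k₁ k₂ f : I × I → ℂ) p =
    (opT₀ u v f - (opT₁ k₁ f + opT₂ k₂ f) : L2Sq) p := rfl
  rw [g6, g1, Pi.sub_apply, g2, Pi.add_apply, g3, g4, g5, Complex.ofReal_add]

/-! ### Parts of the spectrum and the Efimov effect -/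

section Spectrum

variable {H : Type*} [NormedAddCommGroup H] [InnerProductSpace ℂ H]

/-- The real numbers in the spectrum `σ(A)`; for self-adjoint `A` this is the whole spectrum. -/
def realSpectrum (A : H →L[ℂ] H) : Set ℝ := {t | (t : ℂ) ∈ spectrum ℂ A}

/-- `t` is an eigenvalue of `A`. -/
def IsEigenvalue (A : H →L[ℂ] H) (t : ℝ) : Prop :=
  Module.End.HasEigenvalue (A : H →ₗ[ℂ] H) (t : ℂ)

/-- The discrete spectrum `σ_d(A)` of a bounded self-adjoint operator: the eigenvalues of finite
multiplicity that are isolated points of the spectrum. -/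
def discreteSpectrum (A : H →L[ℂ] H) : Set ℝ :=
  {t | IsEigenvalue A t ∧
    FiniteDimensional ℂ (Module.End.eigenspace (A : H →ₗ[ℂ] H) (t : ℂ)) ∧
    ∃ δ > 0, ∀ s ∈ realSpectrum A, |s - t| < δ → s = t}

/-- The essential spectrum `σ_e(A) = σ(A) \ σ_d(A)` of a bounded self-adjoint operator. -/
def essentialSpectrum (A : H →L[ℂ] H) : Set ℝ := realSpectrum A \ discreteSpectrum A

/-- `t ∈ σ_e(A)` is isolated from the left in the essential spectrum of `A`. -/
def IsLeftIsolated (A : H →L[ℂ] H) (t : ℝ) : Prop :=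
  ∃ δ > 0, Ioc (t - δ) t ∩ essentialSpectrum A = {t}

/-- The Efimov effect exists at `t` from the left: `t ∈ σ_e(A)` is isolated from the left in
`σ_e(A)` and is the limit of a sequence of eigenvalues of `A` smaller than `t`. -/
def HasLeftEfimovEffect (A : H →L[ℂ] H) (t : ℝ) : Prop :=
  t ∈ essentialSpectrum A ∧ IsLeftIsolated A t ∧
    ∃ l : ℕ → ℝ, (∀ n, IsEigenvalue A (l n) ∧ l n < t) ∧ Tendsto l atTop (𝓝 t)

end Spectrum

/-- `X = ⋃ₖ [Sₖ, S'ₖ]` is the union of `n` pairwise disjoint closed segments, numbered from left to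
right: `Sₖ ≤ S'ₖ < Sₖ₊₁`. For given `X` there is at most one such `(n, S, S')`, the segments being
the connected components of `X`. A segment may be a single point. -/
def IsSegmentDecomposition (X : Set ℝ) (n : ℕ) (S S' : Fin n → ℝ) : Prop :=
  (X = ⋃ k, Icc (S k) (S' k)) ∧ (∀ k, S k ≤ S' k) ∧ ∀ i j, i < j → S' i < S j

end

/-! Let `A`, `B` be the spectra of the two Friedrichs models, `a = ‖u‖`, `b = ‖v‖`. Since an
integral operator with continuous kernel is compact and `K ≥ 0`, the set `A` is `[0, a]` together
with negative eigenvalues that can accumulate only at `0`, and do so when there are infinitely many;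
likewise for `B`. The core of the proof is that the essential spectrum of `T` consists of the sums
`α + β` (`α ∈ A`, `β ∈ B`) with `α`, `β` not both negative.

Such a sum is never isolated in the spectrum of `T`, because a nonnegative point of `A` or `B` is a
limit of other points of that set (`add_mem_realSpectrum_opT`, `exists_add_ne_near`). Conversely,
let `f s = min s 0`. The product of the two partial integral operators has the continuous kernel
`k₁(x,s) k₂(y,t)` and is compact. As `f` kills the multiplication operators, `f(H₁ ⊗ E) f(E ⊗ H₂)`
is compact too (`isCompactOperator_cfc_mul_cfc`). If `α + β = t` forces both summands to be
negative, this product is invertible where `T - t` is not. The joint functional calculus then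
inverts `T - t` modulo a compact operator, and `t` is not essential (`mem_discreteSpectrum_add`).

The rest concerns subsets of the line. The sums form the union of the segments `[β, β + a]` and `[α,
α + b]`. Those starting close to `0` merge into one segment because `a` or `b` is positive, which
leaves finitely many. A left endpoint `S` must be a negative point of `A` or of `B`
(`left_endpoint`), hence an eigenvalue of one Friedrichs model. Adding to it the negative
eigenvalues of the other model, which tend to `0`, gives eigenvalues of `T` tending to `S` from
below. -/

noncomputable section

/-! ### Approximate eigenvectors and the discrete spectrum of self-adjoint operators -/

section SelfAdjoint

variable {H : Type*} [NormedAddCommGroup H] [InnerProductSpace ℂ H] [CompleteSpace H]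

/-- The orthogonal complement of the range is the kernel of the adjoint, here of `A` itself, so the
lower bound yields dense range as well as injectivity and closed range. -/
theorem isUnit_of_isSelfAdjoint_of_le_norm {A : H →L[ℂ] H} (hA : IsSelfAdjoint A) {c : ℝ}
    (hc : 0 < c) (h : ∀ x, c * ‖x‖ ≤ ‖A x‖) : IsUnit A := by
  rw [ContinuousLinearMap.isUnit_iff_bijective,
    ContinuousLinearMap.bijective_iff_dense_range_and_antilipschitz]
  refine ⟨?_, ⟨c⁻¹, inv_nonneg.2 hc.le⟩, A.antilipschitz_of_bound fun x => ?_⟩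
  · rw [Submodule.topologicalClosure_eq_top_iff, ContinuousLinearMap.orthogonal_range,
      hA.adjoint_eq, Submodule.eq_bot_iff]
    intro x hx
    have h1 : A x = 0 := hx
    have h2 := h x
    rw [h1, norm_zero] at h2
    exact norm_le_zero_iff.1 (by nlinarith [norm_nonneg x])
  · change ‖x‖ ≤ c⁻¹ * ‖A x‖
    rw [inv_mul_eq_div, le_div_iff₀ hc, mul_comm]
    exact h x

theorem isSelfAdjoint_ofReal_algebraMap_sub {A : H →L[ℂ] H} (hA : IsSelfAdjoint A) (t : ℝ) :
    IsSelfAdjoint (algebraMap ℂ (H →L[ℂ] H) (t : ℂ) - A) := by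
  refine IsSelfAdjoint.sub ?_ hA
  rw [IsSelfAdjoint, ← algebraMap_star_comm]
  simp

/-- A real number lies in the spectrum of a self-adjoint operator if and only if it has
approximate eigenvectors. -/
theorem mem_realSpectrum_iff {A : H →L[ℂ] H} (hA : IsSelfAdjoint A) (t : ℝ) :
    t ∈ realSpectrum A ↔ ∀ c > 0, ∃ x, ‖A x - (t : ℂ) • x‖ < c * ‖x‖ := by
  have happ : ∀ x, ‖(algebraMap ℂ (H →L[ℂ] H) (t : ℂ) - A) x‖ = ‖A x - (t : ℂ) • x‖ := by
    intro x
    rw [← norm_neg]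
    congr 1
    simp [Algebra.algebraMap_eq_smul_one]
  constructor
  · intro ht c hc
    by_contra! hcon
    refine ht (isUnit_of_isSelfAdjoint_of_le_norm (isSelfAdjoint_ofReal_algebraMap_sub hA t) hc
      fun x => ?_)
    rw [happ]
    exact hcon x
  · intro h ht
    obtain ⟨R, hR⟩ := ht.exists_left_inv
    obtain ⟨x, hx⟩ := h (‖R‖ + 1)⁻¹ (by positivity)
    have h1 : x = R ((algebraMap ℂ (H →L[ℂ] H) (t : ℂ) - A) x) := by
      have := congrArg (fun S : H →L[ℂ] H => S x) hR
      exact this.symm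
    have h2 : ‖x‖ ≤ ‖R‖ * ‖A x - (t : ℂ) • x‖ := by
      conv_lhs => rw [h1]
      rw [← happ]
      exact R.le_opNorm _
    rw [inv_mul_eq_div, lt_div_iff₀ (by positivity)] at hx
    nlinarith [norm_nonneg (A x - (t : ℂ) • x)]

theorem exists_unit_approx_eigenvector {A : H →L[ℂ] H} (hA : IsSelfAdjoint A) {t : ℝ}
    (ht : t ∈ realSpectrum A) {c : ℝ} (hc : 0 < c) :
    ∃ x, ‖x‖ = 1 ∧ ‖A x - (t : ℂ) • x‖ < c := by
  obtain ⟨x, hx⟩ := (mem_realSpectrum_iff hA t).1 ht c hc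
  have hx0 : 0 < ‖x‖ := by
    by_contra! h0
    have : ‖x‖ = 0 := le_antisymm h0 (norm_nonneg x)
    rw [this, mul_zero] at hx
    exact absurd hx (not_lt.2 (norm_nonneg _))
  have hn : ‖((‖x‖⁻¹ : ℝ) : ℂ)‖ = ‖x‖⁻¹ := by
    rw [Complex.norm_real, norm_inv, norm_norm]
  refine ⟨((‖x‖⁻¹ : ℝ) : ℂ) • x, ?_, ?_⟩
  · rw [norm_smul, hn, inv_mul_cancel₀ hx0.ne']
  · rw [map_smul, smul_comm, ← smul_sub, norm_smul, hn, inv_mul_eq_div, div_lt_iff₀ hx0]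
    exact hx

/-- Along a subsequence `K (x n)` converges; the estimate applied to differences `x m - x n` makes
that subsequence Cauchy. This one extraction gives existence of an eigenvector, finite multiplicity
and isolation below. -/
theorem exists_tendsto_of_compact_estimate {A K : H →L[ℂ] H} (hK : IsCompactOperator K) {t C : ℝ}
    (h : ∀ x, ‖x‖ ≤ C * ‖A x - (t : ℂ) • x‖ + ‖K x‖) (x : ℕ → H) (hx : ∀ n, ‖x n‖ ≤ 1)
    (h0 : Tendsto (fun n => A (x n) - (t : ℂ) • x n) atTop (𝓝 0)) :
    ∃ a, ∃ φ : ℕ → ℕ, StrictMono φ ∧ Tendsto (x ∘ φ) atTop (𝓝 a) ∧ A a - (t : ℂ) • a = 0 := by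
  obtain ⟨Q, hQ, hKQ⟩ := IsCompactOperator.image_closedBall_subset_compact
    (f := (K : H →ₗ[ℂ] H)) hK 1
  obtain ⟨y, -, φ, hφ, hy⟩ := hQ.tendsto_subseq (x := fun n => K (x n))
    fun n => hKQ ⟨x n, by simpa using hx n, rfl⟩
  have hA0 := h0.comp hφ.tendsto_atTop
  have hc : CauchySeq (x ∘ φ) := by
    rw [cauchySeq_iff_tendsto_dist_atTop_0]
    have h1 := cauchySeq_iff_tendsto_dist_atTop_0.1 hA0.cauchySeq
    have h2 := cauchySeq_iff_tendsto_dist_atTop_0.1 hy.cauchySeq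
    have h3 := (h1.const_mul C).add h2
    rw [mul_zero, add_zero] at h3
    refine squeeze_zero (fun _ => dist_nonneg) (fun p => ?_) h3
    have h4 := h (x (φ p.1) - x (φ p.2))
    simp only [Function.comp_apply, dist_eq_norm]
    have h5 : A (x (φ p.1)) - (t : ℂ) • x (φ p.1) - (A (x (φ p.2)) - (t : ℂ) • x (φ p.2)) =
        A (x (φ p.1) - x (φ p.2)) - (t : ℂ) • (x (φ p.1) - x (φ p.2)) := by
      rw [map_sub, smul_sub]; abel
    rw [h5, ← map_sub]
    exact h4
  obtain ⟨a, ha⟩ := cauchySeq_tendsto_of_complete hc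
  refine ⟨a, φ, hφ, ha, ?_⟩
  have h5 : Tendsto (fun n => A ((x ∘ φ) n) - (t : ℂ) • (x ∘ φ) n) atTop
      (𝓝 (A a - (t : ℂ) • a)) :=
    ((A.continuous.tendsto a).comp ha).sub (ha.const_smul _)
  exact tendsto_nhds_unique h5 hA0

/-- If `A - t` is bounded below modulo a compact operator, then `t` is either a regular point or
belongs to the discrete spectrum of the self-adjoint operator `A`. -/
theorem mem_discreteSpectrum_of_compact_estimate {A K : H →L[ℂ] H} (hA : IsSelfAdjoint A)
    (hK : IsCompactOperator K) {t C : ℝ}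
    (h : ∀ x, ‖x‖ ≤ C * ‖A x - (t : ℂ) • x‖ + ‖K x‖) (ht : t ∈ realSpectrum A) :
    t ∈ discreteSpectrum A := by
  have hpos : ∀ n : ℕ, (0 : ℝ) < 1 / ((n : ℝ) + 1) := fun n => by positivity
  refine ⟨?_, ?_, ?_⟩
  · choose x hx1 hx2 using fun n : ℕ => exists_unit_approx_eigenvector hA ht (hpos n)
    obtain ⟨a, φ, -, ha, hA0⟩ := exists_tendsto_of_compact_estimate hK h x (fun n => (hx1 n).le)
      (squeeze_zero_norm (fun n => (hx2 n).le) tendsto_one_div_add_atTop_nhds_zero_nat)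
    have ha1 : ‖a‖ = 1 :=
      tendsto_nhds_unique ha.norm (by simp only [Function.comp_apply, hx1, tendsto_const_nhds])
    refine Module.End.hasEigenvalue_of_hasEigenvector (x := a) ⟨?_, ?_⟩
    · rw [Module.End.mem_eigenspace_iff]
      exact sub_eq_zero.1 hA0
    · rintro rfl
      simp at ha1
  · set N := Module.End.eigenspace (A : H →ₗ[ℂ] H) (t : ℂ)
    have hN : ∀ x : N, A x - (t : ℂ) • (x : H) = 0 := fun x =>
      sub_eq_zero.2 (Module.End.mem_eigenspace_iff.1 x.2)
    refine FiniteDimensional.of_isCompact_closedBall ℂ (r := 1) one_pos (c := (0 : N))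
      (IsSeqCompact.isCompact fun x hx => ?_)
    have hx1 : ∀ n, ‖(x n : H)‖ ≤ 1 := fun n => by simpa using hx n
    obtain ⟨a, φ, hφ, ha, hA0⟩ := exists_tendsto_of_compact_estimate hK h (fun n => (x n : H)) hx1
      (by simp only [hN, tendsto_const_nhds])
    refine ⟨⟨a, Module.End.mem_eigenspace_iff.2 (sub_eq_zero.1 hA0)⟩, ?_, φ, hφ, ?_⟩
    · simpa using le_of_tendsto ha.norm (Eventually.of_forall fun n => hx1 (φ n))
    · rw [tendsto_subtype_rng]
      exact ha
  · by_contra! hcon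
    choose s hs hst hne using fun n : ℕ => hcon _ (hpos n)
    have hd : ∀ n, 0 < |s n - t| := fun n => abs_pos.2 (sub_ne_zero.2 (hne n))
    -- The error is small relative to `|s n - t|`. Since `(t - s n) ⟪a, x n⟫ = ⟪a, (A - s n) x n⟫`
    -- for an eigenvector `a` at `t`, the `x n` become orthogonal to `a`, although a subsequence
    -- converges to the unit vector `a`.
    choose x hx1 hx2 using fun n : ℕ =>
      exists_unit_approx_eigenvector hA (hs n) (mul_pos (hpos n) (hd n))
    have hrw : ∀ n, A (x n) - (t : ℂ) • x n =
        (A (x n) - (s n : ℂ) • x n) + ((s n - t : ℝ) : ℂ) • x n := fun n => by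
      push_cast
      rw [sub_smul]
      abel
    have h0 : Tendsto (fun n => A (x n) - (t : ℂ) • x n) atTop (𝓝 0) := by
      have h2 := (tendsto_one_div_add_atTop_nhds_zero_nat (𝕜 := ℝ)).const_mul 2
      rw [mul_zero] at h2
      refine squeeze_zero_norm (fun n => ?_) h2
      rw [hrw]
      refine (norm_add_le _ _).trans ?_
      rw [norm_smul, hx1, mul_one, Complex.norm_real, Real.norm_eq_abs]
      have h3 : 1 / ((n : ℝ) + 1) ≤ 1 := by
        rw [div_le_one (by positivity)]
        linarith [(Nat.cast_nonneg n : (0 : ℝ) ≤ n)]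
      have h4 := hx2 n
      have h5 := hst n
      nlinarith [hd n]
    obtain ⟨a, φ, hφ, ha, hA0⟩ := exists_tendsto_of_compact_estimate hK h x (fun n => (hx1 n).le) h0
    have ha1 : ‖a‖ = 1 :=
      tendsto_nhds_unique ha.norm (by simp only [Function.comp_apply, hx1, tendsto_const_nhds])
    have hin : ∀ n, ‖inner ℂ a (x n)‖ ≤ 1 / ((n : ℝ) + 1) := by
      intro n
      have h6 : inner ℂ a (A (x n) - (s n : ℂ) • x n) = ((t - s n : ℝ) : ℂ) * inner ℂ a (x n) := by
        have h7 : inner ℂ a (A (x n)) = inner ℂ (A a) (x n) :=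
          ((ContinuousLinearMap.isSelfAdjoint_iff_isSymmetric.1 hA) a (x n)).symm
        rw [inner_sub_right, h7, sub_eq_zero.1 hA0, inner_smul_left, inner_smul_right,
          Complex.conj_ofReal]
        push_cast
        ring
      have h8 : |s n - t| * ‖inner ℂ a (x n)‖ ≤ |s n - t| * (1 / ((n : ℝ) + 1)) := by
        calc |s n - t| * ‖inner ℂ a (x n)‖ = ‖inner ℂ a (A (x n) - (s n : ℂ) • x n)‖ := by
              rw [h6, norm_mul, Complex.norm_real, Real.norm_eq_abs, abs_sub_comm]
          _ ≤ ‖a‖ * ‖A (x n) - (s n : ℂ) • x n‖ := norm_inner_le_norm _ _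
          _ ≤ |s n - t| * (1 / ((n : ℝ) + 1)) := by
              rw [ha1, one_mul, mul_comm]
              exact (hx2 n).le
      exact le_of_mul_le_mul_left h8 (hd n)
    have hin0 : Tendsto (fun n => inner ℂ a (x n)) atTop (𝓝 0) :=
      squeeze_zero_norm hin tendsto_one_div_add_atTop_nhds_zero_nat
    have hin1 : Tendsto (fun n => inner ℂ a (x (φ n))) atTop (𝓝 (inner ℂ a a)) :=
      tendsto_const_nhds.inner ha
    have h9 := tendsto_nhds_unique hin1 (hin0.comp hφ.tendsto_atTop)
    rw [inner_self_eq_zero] at h9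
    rw [h9, norm_zero] at ha1
    exact zero_ne_one ha1

/-! ### Functional calculus modulo compact operators -/

/-- Linearity gives polynomials, and Weierstrass approximation on an interval containing both
spectra gives continuous `f`. `M` is any closed subspace, so that it can be the set of operators
that become compact after multiplication by a fixed operator. -/
theorem cfc_sub_cfc_mem {A U : H →L[ℂ] H} (hA : IsSelfAdjoint A) (hU : IsSelfAdjoint U)
    (M : Submodule ℝ (H →L[ℂ] H)) (hM : IsClosed (M : Set (H →L[ℂ] H)))
    (h : ∀ n : ℕ, A ^ n - U ^ n ∈ M) {f : ℝ → ℝ} (hf : Continuous f) :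
    cfc f A - cfc f U ∈ M := by
  have hpoly : ∀ p : Polynomial ℝ, Polynomial.aeval A p - Polynomial.aeval U p ∈ M := by
    intro p
    rw [Polynomial.aeval_eq_sum_range, Polynomial.aeval_eq_sum_range, ← Finset.sum_sub_distrib]
    refine M.sum_mem fun i _ => ?_
    rw [← smul_sub]
    exact M.smul_mem _ (h i)
  rw [← SetLike.mem_coe, ← hM.closure_eq, Metric.mem_closure_iff]
  intro ε hε
  -- The factor `‖1‖` is `0` on the trivial space, so it cannot simply be replaced by `1`.
  set r := max (‖A‖ * ‖(1 : H →L[ℂ] H)‖) (‖U‖ * ‖(1 : H →L[ℂ] H)‖)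
  obtain ⟨p, hp⟩ := exists_polynomial_near_of_continuousOn (-r) r f hf.continuousOn (ε / 3)
    (by positivity)
  have hnear : ∀ S : H →L[ℂ] H, IsSelfAdjoint S → ‖S‖ * ‖(1 : H →L[ℂ] H)‖ ≤ r →
      ‖cfc f S - Polynomial.aeval S p‖ ≤ ε / 3 := by
    intro S hS hSr
    rw [← cfc_polynomial p S hS, ← cfc_sub f p.eval S hf.continuousOn p.continuous.continuousOn]
    refine norm_cfc_le (by positivity) fun x hx => ?_
    have hx' : |x| ≤ r := (spectrum.norm_le_norm_mul_of_mem hx).trans hSr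
    rw [Real.norm_eq_abs, abs_sub_comm]
    exact (hp x (abs_le.1 hx')).le
  refine ⟨_, hpoly p, ?_⟩
  rw [dist_eq_norm]
  calc ‖cfc f A - cfc f U - (Polynomial.aeval A p - Polynomial.aeval U p)‖
      = ‖(cfc f A - Polynomial.aeval A p) - (cfc f U - Polynomial.aeval U p)‖ := by
        congr 1; abel
    _ ≤ ε / 3 + ε / 3 := (norm_sub_le _ _).trans
        (add_le_add (hnear A hA (le_max_left _ _)) (hnear U hU (le_max_right _ _)))
    _ < ε := by linarith

/-- The factors `U - A` and `V - B` are traded one at a time for functions of the operators. Powers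
telescope, and the commutation hypotheses move the stray powers of `U` and `V` outside the compact
product. Thus `(f(A) - f(U)) (V - B)` is compact, where `f(U) = 0`; then `f(A) (f(B) - f(V))` is
compact, where `f(V) = 0`. -/
theorem isCompactOperator_cfc_mul_cfc {A U B V : H →L[ℂ] H} (hA : IsSelfAdjoint A)
    (hU : IsSelfAdjoint U) (hB : IsSelfAdjoint B) (hV : IsSelfAdjoint V)
    (hUB : Commute U (V - B)) (hAV : Commute A V)
    (hc : IsCompactOperator ((U - A) * (V - B)))
    {f : ℝ → ℝ} (hf : Continuous f) (hfU : cfc f U = 0) (hfV : cfc f V = 0) :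
    IsCompactOperator (cfc f A * cfc f B) := by
  set 𝒦 := (compactOperator (RingHom.id ℂ) H H).restrictScalars ℝ
  have hcl : IsClosed (𝒦 : Set (H →L[ℂ] H)) := isClosed_setOfPred_isCompactOperator
  have hl : ∀ S R : H →L[ℂ] H, R ∈ 𝒦 → S * R ∈ 𝒦 := fun S R hR =>
    IsCompactOperator.clm_comp (f := R) hR S
  have hr : ∀ S R : H →L[ℂ] H, R ∈ 𝒦 → R * S ∈ 𝒦 := fun S R hR =>
    IsCompactOperator.comp_clm (f := R) hR S
  have h1 : cfc f A * (V - B) ∈ 𝒦 := by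
    have h2 : cfc f A - cfc f U ∈ 𝒦.comap (LinearMap.mulRight ℝ (V - B)) := by
      refine cfc_sub_cfc_mem hA hU _ (hcl.preimage (continuous_mul_const (V - B))) ?_ hf
      intro n
      induction n with
      | zero => simp
      | succ n ih =>
        have h3 : A ^ (n + 1) - U ^ (n + 1) = A * (A ^ n - U ^ n) - (U - A) * U ^ n := by
          rw [pow_succ', pow_succ']; noncomm_ring
        have h4 : (U - A) * U ^ n * (V - B) = (U - A) * (V - B) * U ^ n := by
          rw [mul_assoc, (hUB.pow_left n).eq, mul_assoc]
        rw [Submodule.mem_comap, LinearMap.mulRight_apply, h3, sub_mul, h4, mul_assoc A]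
        exact 𝒦.sub_mem (hl _ _ ih) (hr _ _ hc)
    rw [hfU, sub_zero] at h2
    exact h2
  have h2 : cfc f B - cfc f V ∈ 𝒦.comap (LinearMap.mulLeft ℝ (cfc f A)) := by
    refine cfc_sub_cfc_mem hB hV _ (hcl.preimage (continuous_const_mul (cfc f A))) ?_ hf
    intro n
    induction n with
    | zero => simp
    | succ n ih =>
      have h3 : B ^ (n + 1) - V ^ (n + 1) = (B ^ n - V ^ n) * B - V ^ n * (V - B) := by
        rw [pow_succ, pow_succ]; noncomm_ring
      have h4 : cfc f A * (V ^ n * (V - B)) = V ^ n * (cfc f A * (V - B)) := by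
        rw [← mul_assoc, ((hAV.cfc_real f).pow_right n).eq, mul_assoc]
      rw [Submodule.mem_comap, LinearMap.mulLeft_apply, h3, mul_sub, h4, ← mul_assoc]
      exact 𝒦.sub_mem (hr _ _ ih) (hl _ _ h1)
  rw [hfV, sub_zero] at h2
  exact h2

/-- Joint functional calculus of two commuting self-adjoint operators: `t` is not in the essential
spectrum of `A + B` when `α + β = t` has only solutions with `f α * f β ≠ 0` in the product of the
spectra, where `f(A) f(B)` is compact. -/
theorem mem_discreteSpectrum_add {A B : H →L[ℂ] H} (hA : IsSelfAdjoint A) (hB : IsSelfAdjoint B)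
    (hAB : Commute A B) {f : ℝ → ℝ} (hf : Continuous f)
    (hc : IsCompactOperator (cfc f A * cfc f B)) {t : ℝ}
    (hne : ∀ α ∈ realSpectrum A, ∀ β ∈ realSpectrum B, α + β = t → f α * f β ≠ 0)
    (ht : t ∈ realSpectrum (A + B)) : t ∈ discreteSpectrum (A + B) := by
  -- The normal operator `A + iB` carries the joint functional calculus: its spectrum projects into
  -- those of `A` and `B`.
  set N : H →L[ℂ] H := A + Complex.I • B
  have hre : (realPart N : H →L[ℂ] H) = A := by
    rw [map_add, realPart_I_smul, hB.imaginaryPart, neg_zero, add_zero, hA.coe_realPart]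
  have him : (imaginaryPart N : H →L[ℂ] H) = B := by
    rw [map_add, imaginaryPart_I_smul, hA.imaginaryPart, zero_add, hB.coe_realPart]
  have hN : IsStarNormal N := by
    rw [isStarNormal_iff_commute_realPart_imaginaryPart, hre, him]
    exact hAB
  have hreS : ∀ z ∈ spectrum ℂ N, z.re ∈ realSpectrum A := fun z hz => by
    have := spectrum_realPart N
    rw [hre] at this
    change ((z.re : ℝ) : ℂ) ∈ spectrum ℂ A
    rw [this]
    exact ⟨z, hz, rfl⟩
  have himS : ∀ z ∈ spectrum ℂ N, z.im ∈ realSpectrum B := fun z hz => by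
    have := spectrum_imaginaryPart N
    rw [him] at this
    change ((z.im : ℝ) : ℂ) ∈ spectrum ℂ B
    rw [this]
    exact ⟨z, hz, rfl⟩
  -- By `hne`, `d` and `w` have no common zero on the spectrum of `N`. Hence `g d + m w = 1` there,
  -- with `g`, `m` equal to `d`, `w` divided by `d² + w²`.
  set d : ℂ → ℝ := fun z => z.re + z.im - t
  set w : ℂ → ℝ := fun z => f z.re * f z.im
  have hd : Continuous d := by fun_prop
  have hw : Continuous w := by fun_prop
  have hq : ∀ z ∈ spectrum ℂ N, d z ^ 2 + w z ^ 2 ≠ 0 := by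
    intro z hz h0
    have h1 : d z = 0 := by nlinarith [sq_nonneg (d z), sq_nonneg (w z)]
    have h2 : w z = 0 := by nlinarith [sq_nonneg (d z), sq_nonneg (w z)]
    exact hne _ (hreS z hz) _ (himS z hz) (by simp only [d] at h1; linarith) h2
  obtain ⟨g, m, hg, hm, hgm⟩ : ∃ g m : ℂ → ℂ, ContinuousOn g (spectrum ℂ N) ∧
      ContinuousOn m (spectrum ℂ N) ∧
      ∀ z ∈ spectrum ℂ N, g z * (d z : ℂ) + m z * (w z : ℂ) = 1 := by
    refine ⟨fun z => ((d z / (d z ^ 2 + w z ^ 2) : ℝ) : ℂ),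
      fun z => ((w z / (d z ^ 2 + w z ^ 2) : ℝ) : ℂ),
      Complex.continuous_ofReal.comp_continuousOn (hd.continuousOn.div (by fun_prop) hq),
      Complex.continuous_ofReal.comp_continuousOn (hw.continuousOn.div (by fun_prop) hq),
      fun z hz => ?_⟩
    have := hq z hz
    rw [← Complex.ofReal_mul, ← Complex.ofReal_mul, ← Complex.ofReal_add, ← Complex.ofReal_one]
    congr 1
    field_simp
  have hdc : ContinuousOn (fun z => (d z : ℂ)) (spectrum ℂ N) :=
    (Complex.continuous_ofReal.comp hd).continuousOn
  have hwc : ContinuousOn (fun z => (w z : ℂ)) (spectrum ℂ N) :=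
    (Complex.continuous_ofReal.comp hw).continuousOn
  set G := cfc g N
  set M := cfc m N
  have hdN : cfc (fun z => (d z : ℂ)) N = A + B - algebraMap ℂ (H →L[ℂ] H) (t : ℂ) := by
    have h1 : (fun z => (d z : ℂ)) = fun z : ℂ => ((z.re : ℂ) + (z.im : ℂ)) - (t : ℂ) := by
      funext z
      simp [d]
    have h2 : ContinuousOn (fun z : ℂ => (z.re : ℂ)) (spectrum ℂ N) := by fun_prop
    have h3 : ContinuousOn (fun z : ℂ => (z.im : ℂ)) (spectrum ℂ N) := by fun_prop
    rw [h1, cfc_sub (fun z : ℂ => (z.re : ℂ) + (z.im : ℂ)) (fun _ => (t : ℂ)) N (h2.add h3)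
        continuousOn_const, cfc_add N _ _ h2 h3,
      cfc_const (t : ℂ) N hN, cfc_re_id N, cfc_im_id N, hre, him]
  have hwN : cfc (fun z => (w z : ℂ)) N = cfc f A * cfc f B := by
    have h1 : (fun z => (w z : ℂ)) = fun z : ℂ => (f z.re : ℂ) * (f z.im : ℂ) := by
      funext z
      simp [w]
    have hfre : Continuous fun z : ℂ => (f z.re : ℂ) := by fun_prop
    have hfim : Continuous fun z : ℂ => (f z.im : ℂ) := by fun_prop
    have h2 := cfc_realPart (fun z : ℂ => (f z.re : ℂ)) N hfre.continuousOn hN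
    have h3 := cfc_imaginaryPart (fun z : ℂ => (f z.re : ℂ)) N hfre.continuousOn hN
    simp only [Complex.ofReal_re] at h2 h3
    rw [h1, cfc_mul _ _ N hfre.continuousOn hfim.continuousOn, ← h2, ← h3, hre, him, cfc_real_eq_complex f hA, cfc_real_eq_complex f hB]
  -- Thus `G` is a left inverse of `A + B - t` up to a compact operator.
  have hone : G * (A + B - algebraMap ℂ (H →L[ℂ] H) (t : ℂ)) + M * (cfc f A * cfc f B) = 1 := by
    rw [← hdN, ← hwN, ← cfc_mul _ _ N hg hdc, ← cfc_mul _ _ N hm hwc,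
      ← cfc_add N (fun z => g z * (d z : ℂ)) (fun z => m z * (w z : ℂ)) (hg.mul hdc) (hm.mul hwc),
      ← cfc_one ℂ N]
    exact cfc_congr hgm
  refine mem_discreteSpectrum_of_compact_estimate (hA.add hB) (K := M * (cfc f A * cfc f B))
    (hc.clm_comp M) (C := ‖G‖)
    (fun x => ?_) ht
  have h1 : x = G ((A + B) x - (t : ℂ) • x) + M ((cfc f A * cfc f B) x) := by
    have := congrArg (fun S : H →L[ℂ] H => S x) hone
    simpa [Algebra.algebraMap_eq_smul_one] using this.symm
  conv_lhs => rw [h1]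
  exact (norm_add_le _ _).trans (add_le_add (G.le_opNorm _) le_rfl)

theorem cfc_eq_zero_of_realSpectrum {A : H →L[ℂ] H} {f : ℝ → ℝ}
    (h : ∀ s ∈ realSpectrum A, f s = 0) : cfc f A = 0 := by
  rw [← cfc_zero ℝ A]
  refine cfc_congr fun s hs => h s ?_
  have h1 := (spectrum.algebraMap_mem_iff ℂ (R := ℝ) (r := s) (a := A)).2 hs
  exact h1

/-- Let `A` and `B` be commuting self-adjoint perturbations of the nonnegative operators `U` and
`V`. If the product of the perturbations is compact and `α + β = t` in the product of the spectra
forces `α < 0` and `β < 0`, then `t` is not in the essential spectrum of `A + B`. -/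
theorem mem_discreteSpectrum_add_of_isCompactOperator {A U B V : H →L[ℂ] H} (hA : IsSelfAdjoint A)
    (hU : IsSelfAdjoint U) (hB : IsSelfAdjoint B) (hV : IsSelfAdjoint V) (hAB : Commute A B)
    (hUB : Commute U (V - B)) (hAV : Commute A V)
    (hc : IsCompactOperator ((U - A) * (V - B)))
    (hU0 : ∀ s ∈ realSpectrum U, 0 ≤ s) (hV0 : ∀ s ∈ realSpectrum V, 0 ≤ s) {t : ℝ}
    (hne : ∀ α ∈ realSpectrum A, ∀ β ∈ realSpectrum B, α + β = t → α < 0 ∧ β < 0)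
    (ht : t ∈ realSpectrum (A + B)) : t ∈ discreteSpectrum (A + B) := by
  -- This function vanishes on the nonnegative spectra of `U` and `V` and is nonzero at every
  -- negative number.
  have hf : Continuous fun s : ℝ => min s 0 := by fun_prop
  refine mem_discreteSpectrum_add hA hB hAB hf
    (isCompactOperator_cfc_mul_cfc hA hU hB hV hUB hAV hc hf
      (cfc_eq_zero_of_realSpectrum fun s hs => min_eq_right (hU0 s hs))
      (cfc_eq_zero_of_realSpectrum fun s hs => min_eq_right (hV0 s hs))) ?_ ht
  intro α hα β hβ h
  obtain ⟨h1, h2⟩ := hne α hα β hβ h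
  rw [min_eq_left h1.le, min_eq_left h2.le]
  exact mul_ne_zero h1.ne h2.ne

end SelfAdjoint


/-! ### Compactness of integral operators with continuous kernel -/

section KernelCompact

variable {X : Type*} [MeasureSpace X] [IsProbabilityMeasure (volume : Measure X)]

theorem integral_norm_Lp_two_le (f : Lp ℂ 2 (volume : Measure X)) : ∫ s, ‖f s‖ ≤ ‖f‖ := by
  rw [integral_norm_eq_lintegral_enorm (Lp.aestronglyMeasurable f),
    ← eLpNorm_one_eq_lintegral_enorm, Lp.norm_def]
  exact ENNReal.toReal_mono (Lp.memLp f).2.ne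
    (eLpNorm_le_eLpNorm_of_exponent_le (by norm_num) (Lp.aestronglyMeasurable f))

theorem integrable_Lp_two (f : Lp ℂ 2 (volume : Measure X)) : Integrable f volume :=
  (Lp.memLp f).integrable (by norm_num)

variable [TopologicalSpace X] [CompactSpace X]

theorem integrable_continuous_mul [OpensMeasurableSpace X] (h : C(X, ℂ))
    (f : Lp ℂ 2 (volume : Measure X)) : Integrable (fun s => h s * f s) volume :=
  (integrable_Lp_two f).bdd_mul h.continuous.measurable.aestronglyMeasurable
    (Eventually.of_forall fun x => h.norm_coe_le_norm x)

theorem norm_integral_continuous_mul_le [OpensMeasurableSpace X] (h : C(X, ℂ))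
    (f : Lp ℂ 2 (volume : Measure X)) : ‖∫ s, h s * f s‖ ≤ ‖h‖ * ∫ s, ‖f s‖ := by
  rw [← integral_const_mul]
  refine norm_integral_le_of_norm_le ((integrable_Lp_two f).norm.const_mul _)
    (Eventually.of_forall fun s => ?_)
  rw [norm_mul]
  exact mul_le_mul_of_nonneg_right (h.norm_coe_le_norm s) (norm_nonneg _)

omit [MeasureSpace X] [IsProbabilityMeasure (volume : Measure X)] in
theorem norm_curry_apply_le (g : C(X × X, ℂ)) (x : X) : ‖g.curry x‖ ≤ ‖g‖ :=
  (ContinuousMap.norm_le _ (norm_nonneg g)).2 fun s => g.norm_coe_le_norm (x, s)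

/-- An integral operator with continuous kernel is compact. -/
theorem isCompactOperator_kernelOp_snd [BorelSpace X] [OpensMeasurableSpace (X × X)]
    (g : C(X × X, ℂ)) :
    IsCompactOperator (kernelOp g Prod.snd
      (measurePreserving_snd (μ := (volume : Measure X)) (ν := (volume : Measure X)))) := by
  -- The unit ball is mapped to functions bounded by `‖g‖` whose oscillation is controlled by that
  -- of `x ↦ g(x, ·)` in the sup norm. This control is uniform, so Arzelà–Ascoli applies without a
  -- metric on `X`.
  set A : Set (BoundedContinuousFunction X ℂ) :=
    {F | (∀ x, F x ∈ Metric.closedBall (0 : ℂ) ‖g‖) ∧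
      ∀ x x', dist (F x) (F x') ≤ dist (g.curry x) (g.curry x')}
  have hcomp : IsCompact (closure A) := by
    refine BoundedContinuousFunction.arzela_ascoli _ (isCompact_closedBall (0 : ℂ) ‖g‖) A
      (fun F x hF => hF.1 x) fun x₀ => ?_
    rw [Metric.equicontinuousAt_iff_right]
    intro ε hε
    filter_upwards [Metric.tendsto_nhds.1 (g.curry.continuous.tendsto x₀) ε hε] with x hx F
    rw [dist_comm] at hx
    exact (F.2.2 x₀ x).trans_lt hx
  have key := isCompactOperator_iff_image_closedBall_subset_compact
    ((kernelOp g Prod.snd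
      (measurePreserving_snd (μ := (volume : Measure X)) (ν := (volume : Measure X))) :
      Lp ℂ 2 (volume : Measure X) →L[ℂ] Lp ℂ 2 (volume : Measure X)) :
      Lp ℂ 2 (volume : Measure X) →ₗ[ℂ] Lp ℂ 2 (volume : Measure X)) one_pos
  refine key.2 ⟨_, hcomp.image
    (BoundedContinuousFunction.toLp (α := X) (E := ℂ) 2 volume ℂ).continuous, ?_⟩
  rintro _ ⟨f, hf, rfl⟩
  have hf1 : ∫ s, ‖f s‖ ≤ 1 := (integral_norm_Lp_two_le f).trans (by simpa using hf)
  have hbound : ∀ h : C(X, ℂ), ‖∫ s, h s * f s‖ ≤ ‖h‖ := fun h =>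
    (norm_integral_continuous_mul_le h f).trans (mul_le_of_le_one_right (norm_nonneg h) hf1)
  have hdist : ∀ x x', dist (∫ s, g (x, s) * f s) (∫ s, g (x', s) * f s) ≤
      dist (g.curry x) (g.curry x') := by
    intro x x'
    have h1 := hbound (g.curry x - g.curry x')
    simp only [ContinuousMap.sub_apply, sub_mul] at h1
    rw [integral_sub (integrable_continuous_mul (g.curry x) f)
      (integrable_continuous_mul (g.curry x') f)] at h1
    rw [dist_eq_norm, dist_eq_norm]
    exact h1
  have hcont : Continuous fun x => ∫ s, g (x, s) * f s := by
    rw [continuous_iff_continuousAt]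
    intro x₀
    refine tendsto_iff_dist_tendsto_zero.2 (squeeze_zero (fun _ => dist_nonneg)
      (fun x => hdist x x₀) ?_)
    exact tendsto_iff_dist_tendsto_zero.1 (g.curry.continuous.tendsto x₀)
  have hsup : ∀ x, ‖∫ s, g (x, s) * f s‖ ≤ ‖g‖ := fun x =>
    (hbound (g.curry x)).trans (norm_curry_apply_le g x)
  refine ⟨BoundedContinuousFunction.ofNormedAddCommGroup _ hcont ‖g‖ hsup,
    subset_closure ⟨fun x => by simpa using hsup x, hdist⟩, ?_⟩
  apply Lp.ext
  filter_upwards [kernelOp_ae g Prod.snd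
      (measurePreserving_snd (μ := (volume : Measure X)) (ν := (volume : Measure X))) f,
    BoundedContinuousFunction.coeFn_toLp 2 volume ℂ
      (BoundedContinuousFunction.ofNormedAddCommGroup _ hcont ‖g‖ hsup)] with x h1 h2
  exact h2.trans h1.symm

end KernelCompact

/-! ### Multiplication operators and their spectrum -/

section MulOp

variable {X : Type*} [MeasureSpace X] [TopologicalSpace X] [CompactSpace X] [OpensMeasurableSpace X]

theorem mulOp_add (g h : C(X, ℂ)) : mulOp (g + h) = mulOp g + mulOp h := by
  ext1 f
  apply Lp.ext
  filter_upwards [mulOp_ae (g + h) f, mulOp_ae g f, mulOp_ae h f,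
    Lp.coeFn_add (mulOp g f) (mulOp h f)] with x h1 h2 h3 h4
  have h5 : (mulOp g + mulOp h) f = mulOp g f + mulOp h f := rfl
  rw [h1, h5, h4, Pi.add_apply, h2, h3, ContinuousMap.add_apply, add_mul]

theorem mulOp_mul (g h : C(X, ℂ)) : mulOp (g * h) = mulOp g * mulOp h := by
  ext1 f
  apply Lp.ext
  filter_upwards [mulOp_ae (g * h) f, mulOp_ae h f, mulOp_ae g (mulOp h f)] with x h1 h2 h3
  have h4 : (mulOp g * mulOp h) f = mulOp g (mulOp h f) := rfl
  rw [h1, h4, h3, h2, ContinuousMap.mul_apply, mul_assoc]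

theorem commute_mulOp (g h : C(X, ℂ)) : Commute (mulOp g) (mulOp h) := by
  rw [Commute, SemiconjBy, ← mulOp_mul, ← mulOp_mul, mul_comm]

theorem mulOp_const (c : ℂ) : mulOp (ContinuousMap.const X c) = algebraMap ℂ _ c := by
  ext1 f
  apply Lp.ext
  filter_upwards [mulOp_ae (ContinuousMap.const X c) f, Lp.coeFn_smul c f] with x h1 h2
  have h3 : (algebraMap ℂ (Lp ℂ 2 (volume : Measure X) →L[ℂ] Lp ℂ 2 (volume : Measure X)) c) f =
      c • f := by simp [Algebra.algebraMap_eq_smul_one]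
  rw [h1, h3, h2]
  rfl

theorem norm_mulOp_apply_le (g : C(X, ℂ)) (f : Lp ℂ 2 (volume : Measure X)) :
    ‖mulOp g f‖ ≤ ‖g‖ * ‖f‖ := by
  refine Lp.norm_le_mul_norm_of_ae_le_mul ?_
  filter_upwards [mulOp_ae g f] with x h1
  rw [h1, norm_mul]
  exact mul_le_mul_of_nonneg_right (g.norm_coe_le_norm x) (norm_nonneg _)

theorem isSelfAdjoint_mulOp_toComplexMap (u : C(X, ℝ)) :
    IsSelfAdjoint (mulOp (toComplexMap u)) := by
  rw [ContinuousLinearMap.isSelfAdjoint_iff_isSymmetric]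
  intro f g
  change inner ℂ (mulOp (toComplexMap u) f) g = inner ℂ f (mulOp (toComplexMap u) g)
  rw [L2.inner_def, L2.inner_def]
  refine integral_congr_ae ?_
  filter_upwards [mulOp_ae (toComplexMap u) f, mulOp_ae (toComplexMap u) g] with x h1 h2
  rw [h1, h2]
  simp only [RCLike.inner_apply, map_mul]
  have : conj (toComplexMap u x) = toComplexMap u x := Complex.conj_ofReal _
  rw [this]
  ring

/-- The spectrum of multiplication by `u` lies in the range of `u`. -/
theorem mem_range_of_mem_realSpectrum_mulOp {u : C(X, ℝ)} {t : ℝ}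
    (ht : t ∈ realSpectrum (mulOp (toComplexMap u))) : t ∈ range u := by
  by_contra hcon
  have hne : ∀ x, ((t : ℂ) - u x) ≠ 0 := fun x h0 => hcon ⟨x, by
    have := sub_eq_zero.1 h0
    exact_mod_cast this.symm⟩
  set g : C(X, ℂ) := ContinuousMap.const X (t : ℂ) + toComplexMap (-u)
  have hgx : ∀ x, g x = (t : ℂ) - u x := fun x => by
    change (t : ℂ) + ((-u x : ℝ) : ℂ) = _
    push_cast
    ring
  set r : C(X, ℂ) := ⟨fun x => (g x)⁻¹, g.continuous.inv₀ fun x => by rw [hgx]; exact hne x⟩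
  have hgr : g * r = ContinuousMap.const X 1 := by
    ext x
    exact mul_inv_cancel₀ (by rw [hgx]; exact hne x)
  have hg : mulOp g = algebraMap ℂ _ (t : ℂ) - mulOp (toComplexMap u) := by
    have h1 : ContinuousMap.const X (t : ℂ) = g + toComplexMap u := by
      ext x
      rw [ContinuousMap.add_apply, hgx]
      simp [toComplexMap]
    rw [← mulOp_const, h1, mulOp_add g (toComplexMap u)]
    exact (add_sub_cancel_right (mulOp g) _).symm
  refine ht ?_
  change IsUnit _
  rw [← hg]
  have h2 : mulOp g * mulOp r = 1 := by rw [← mulOp_mul, hgr, mulOp_const, map_one]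
  exact ⟨⟨mulOp g, mulOp r, h2, by rw [(commute_mulOp r g).eq, h2]⟩, rfl⟩

end MulOp


/-! ### Slices of square integrable functions -/

section Slices

theorem norm_sq_Lp_two_eq_integral {X : Type*} [MeasurableSpace X] {μ : Measure X}
    (f : Lp ℂ 2 μ) : ‖f‖ ^ 2 = ∫ x, ‖f x‖ ^ 2 ∂μ := by
  have h := inner_self_eq_norm_sq_to_K (𝕜 := ℂ) f
  rw [L2.inner_def] at h
  simp_rw [inner_self_eq_norm_sq_to_K] at h
  have h1 : ((∫ x, ‖f x‖ ^ 2 ∂μ : ℝ) : ℂ) = ((‖f‖ ^ 2 : ℝ) : ℂ) := by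
    rw [← integral_complex_ofReal]
    simpa using h
  exact_mod_cast h1.symm

/-- The slice `y ↦ f (e (x, y))` of a square integrable function (zero if it is not square
integrable). -/
def sliceLp (e : I × I ≃ᵐ I × I) (f : L2Sq) (x : I) : L2I :=
  open Classical in
  if h : MemLp (fun y => f (e (x, y))) 2 (volume : Measure I) then h.toLp _ else 0

variable {e : I × I ≃ᵐ I × I}

theorem sliceLp_ae (he : MeasurePreserving e volume volume) (f : L2Sq) :
    ∀ᵐ x : I, sliceLp e f x =ᵐ[volume] fun y => f (e (x, y)) := by
  have hm : Measurable fun p => f (e p) :=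
    (Lp.stronglyMeasurable f).measurable.comp e.measurable
  have hint : Integrable (fun p => ‖f (e p)‖ ^ 2) (volume : Measure (I × I)) :=
    (memLp_two_iff_integrable_sq_norm hm.aestronglyMeasurable).1
      ((Lp.memLp f).comp_measurePreserving he)
  filter_upwards [hint.prod_right_ae] with x hx
  have hx2 : MemLp (fun y => f (e (x, y))) 2 (volume : Measure I) :=
    (memLp_two_iff_integrable_sq_norm
      (hm.comp measurable_prodMk_left).aestronglyMeasurable).2 hx
  rw [sliceLp, dif_pos hx2]
  exact hx2.coeFn_toLp

theorem integrable_inner_comp (he : MeasurePreserving e volume volume) (f g : L2Sq) :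
    Integrable (fun p => inner ℂ (f (e p)) (g (e p))) (volume : Measure (I × I)) :=
  (he.integrable_comp_emb e.measurableEmbedding).2 (L2.integrable_inner f g)

theorem inner_sliceLp_ae (he : MeasurePreserving e volume volume) (f g : L2Sq) :
    (fun x => inner ℂ (sliceLp e f x) (sliceLp e g x)) =ᵐ[volume]
      fun x : I => ∫ y : I, inner ℂ (f (e (x, y))) (g (e (x, y))) := by
  filter_upwards [sliceLp_ae he f, sliceLp_ae he g] with x hf hg
  rw [L2.inner_def]
  refine integral_congr_ae ?_
  filter_upwards [hf, hg] with y h1 h2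
  rw [h1, h2]

theorem integrable_inner_sliceLp (he : MeasurePreserving e volume volume) (f g : L2Sq) :
    Integrable (fun x => inner ℂ (sliceLp e f x) (sliceLp e g x)) (volume : Measure I) :=
  (integrable_inner_comp he f g).integral_prod_left.congr (inner_sliceLp_ae he f g).symm

theorem inner_eq_integral_sliceLp (he : MeasurePreserving e volume volume) (f g : L2Sq) :
    inner ℂ f g = ∫ x, inner ℂ (sliceLp e f x) (sliceLp e g x) := by
  rw [integral_congr_ae (inner_sliceLp_ae he f g), L2.inner_def,
    ← he.integral_comp' (fun p => inner ℂ (f p) (g p))]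
  exact integral_prod _ (integrable_inner_comp he f g)

theorem integrable_norm_sq_sliceLp (he : MeasurePreserving e volume volume) (f : L2Sq) :
    Integrable (fun x => ‖sliceLp e f x‖ ^ 2) (volume : Measure I) := by
  have h := (integrable_inner_sliceLp he f f).re
  simpa only [inner_self_eq_norm_sq] using h

theorem norm_sq_eq_integral_sliceLp (he : MeasurePreserving e volume volume) (f : L2Sq) :
    ‖f‖ ^ 2 = ∫ x, ‖sliceLp e f x‖ ^ 2 := by
  have h := inner_self_eq_norm_sq_to_K (𝕜 := ℂ) f
  rw [inner_eq_integral_sliceLp he] at h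
  simp_rw [inner_self_eq_norm_sq_to_K] at h
  have h1 : ((∫ x, ‖sliceLp e f x‖ ^ 2 : ℝ) : ℂ) = ((‖f‖ ^ 2 : ℝ) : ℂ) := by
    rw [← integral_complex_ofReal]
    simpa using h
  exact_mod_cast h1.symm

theorem sliceLp_sub_smul (he : MeasurePreserving e volume volume) (f g : L2Sq) (c : ℂ) :
    ∀ᵐ x : I, sliceLp e (f - c • g) x = sliceLp e f x - c • sliceLp e g x := by
  have h : ∀ᵐ p : I × I, (f - c • g : L2Sq) (e p) = f (e p) - c * g (e p) := by
    refine he.quasiMeasurePreserving.ae (p := fun q => (f - c • g : L2Sq) q = f q - c * g q) ?_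
    filter_upwards [Lp.coeFn_sub f (c • g), Lp.coeFn_smul c g] with q h1 h2
    rw [h1, Pi.sub_apply, h2]
    rfl
  filter_upwards [sliceLp_ae he f, sliceLp_ae he g, sliceLp_ae he (f - c • g),
    Measure.ae_ae_of_ae_prod h] with x h1 h2 h3 h4
  apply Lp.ext
  filter_upwards [h1, h2, h3, h4, Lp.coeFn_sub (sliceLp e f x) (c • sliceLp e g x),
    Lp.coeFn_smul c (sliceLp e g x)] with y g1 g2 g3 g4 g5 g6
  rw [g3, g4, g5, Pi.sub_apply, g6, Pi.smul_apply, g1, g2, smul_eq_mul]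

/-- An operator acting slicewise as a self-adjoint operator is self-adjoint. -/
theorem isSelfAdjoint_of_sliceLp (he : MeasurePreserving e volume volume) {S : L2I →L[ℂ] L2I}
    {R : L2Sq →L[ℂ] L2Sq} (hS : IsSelfAdjoint S)
    (hSR : ∀ f, ∀ᵐ x : I, S (sliceLp e f x) = sliceLp e (R f) x) : IsSelfAdjoint R := by
  rw [ContinuousLinearMap.isSelfAdjoint_iff_isSymmetric] at hS ⊢
  intro f g
  change inner ℂ (R f) g = inner ℂ f (R g)
  rw [inner_eq_integral_sliceLp he, inner_eq_integral_sliceLp he]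
  refine integral_congr_ae ?_
  filter_upwards [hSR f, hSR g] with x h1 h2
  rw [← h1, ← h2]
  exact hS _ _

/-- The spectrum of an operator acting slicewise as `S` is contained in the spectrum of `S`. -/
theorem realSpectrum_subset_of_sliceLp (he : MeasurePreserving e volume volume)
    {S : L2I →L[ℂ] L2I} {R : L2Sq →L[ℂ] L2Sq} (hS : IsSelfAdjoint S)
    (hSR : ∀ f, ∀ᵐ x : I, S (sliceLp e f x) = sliceLp e (R f) x) :
    realSpectrum R ⊆ realSpectrum S := by
  intro t ht
  by_contra hcon
  rw [mem_realSpectrum_iff hS] at hcon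
  push Not at hcon
  obtain ⟨c, hc, hcS⟩ := hcon
  obtain ⟨f, hf⟩ := (mem_realSpectrum_iff (isSelfAdjoint_of_sliceLp he hS hSR) t).1 ht c hc
  -- The lower bound for `S - t` on each slice, squared and integrated over the slices, becomes the
  -- same lower bound for `R - t`.
  refine absurd hf (not_lt.2 (le_of_sq_le_sq ?_ (norm_nonneg _)))
  rw [mul_pow, norm_sq_eq_integral_sliceLp he f, norm_sq_eq_integral_sliceLp he,
    ← integral_const_mul]
  refine integral_mono_ae ((integrable_norm_sq_sliceLp he f).const_mul _)
    (integrable_norm_sq_sliceLp he _) ?_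
  filter_upwards [hSR f, sliceLp_sub_smul he (R f) f t] with x h1 h2
  rw [h2, ← h1, ← mul_pow]
  exact pow_le_pow_left₀ (by positivity) (hcS _) 2

/-- The map `e` rearranges coordinates so that the active variable comes second: the swap serves
operators acting in `x`, the identity those acting in `y`. -/
theorem friedrichs_sliceLp (he : MeasurePreserving e volume volume) {u : C(I, ℝ)}
    {k : C(I × I, ℂ)} {R : L2Sq →L[ℂ] L2Sq}
    (hR : ∀ f : L2Sq, ∀ᵐ q : I × I, R f (e q) =
      (u q.2 : ℂ) * f (e q) - ∫ s, k (q.2, s) * f (e (q.1, s))) (f : L2Sq) :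
    ∀ᵐ x : I, friedrichs u k (sliceLp e f x) = sliceLp e (R f) x := by
  filter_upwards [sliceLp_ae he f, sliceLp_ae he (R f), Measure.ae_ae_of_ae_prod (hR f)]
    with x h1 h2 h3
  apply Lp.ext
  filter_upwards [friedrichs_ae u k (sliceLp e f x), h1, h2, h3] with y g1 g2 g3 g4
  rw [g1, g2, g3, g4]
  congr 1
  refine integral_congr_ae ?_
  filter_upwards [h1] with s hs
  rw [hs]

end Slices

/-! ### The operators acting in one of the two variables -/

section TwoVariables

/-- Almost every line meets a null set of the square in a null set. This permits substituting an
almost-everywhere formula under a partial integral. -/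
theorem ae_ae_slice₁ {P : I × I → Prop} (h : ∀ᵐ q, P q) : ∀ᵐ p : I × I, ∀ᵐ s, P (s, p.2) :=
  Measure.ae_ae_of_ae_prod (μ := (volume : Measure (I × I))) (ν := (volume : Measure I))
    (measurePreserving_slice₁.quasiMeasurePreserving.ae h)

theorem ae_ae_slice₂ {P : I × I → Prop} (h : ∀ᵐ q, P q) : ∀ᵐ p : I × I, ∀ᵐ s, P (p.1, s) :=
  Measure.ae_ae_of_ae_prod (μ := (volume : Measure (I × I))) (ν := (volume : Measure I))
    (measurePreserving_slice₂.quasiMeasurePreserving.ae h)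

theorem opT₀_ae (u v : C(I, ℝ)) (f : L2Sq) :
    opT₀ u v f =ᵐ[volume] fun p => ((u p.1 : ℂ) + (v p.2 : ℂ)) * f p := by
  filter_upwards [mulOp_ae (toComplexMap (u.comp ContinuousMap.fst + v.comp ContinuousMap.snd)) f]
    with p h
  rw [← Complex.ofReal_add]
  exact h

theorem opT₁_ae (k : C(I × I, ℂ)) (f : L2Sq) :
    opT₁ k f =ᵐ[volume] fun p => ∫ s, k (p.1, s) * f (s, p.2) :=
  kernelOp_ae _ _ measurePreserving_slice₁ f

theorem opT₂_ae (k : C(I × I, ℂ)) (f : L2Sq) :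
    opT₂ k f =ᵐ[volume] fun p => ∫ t, k (p.2, t) * f (p.1, t) :=
  kernelOp_ae _ _ measurePreserving_slice₂ f

theorem commute_opT₀_opT₁ (v : C(I, ℝ)) (k : C(I × I, ℂ)) : Commute (opT₀ 0 v) (opT₁ k) := by
  ext1 f
  change opT₀ 0 v (opT₁ k f) = opT₁ k (opT₀ 0 v f)
  apply Lp.ext
  filter_upwards [opT₀_ae 0 v (opT₁ k f), opT₁_ae k f, opT₁_ae k (opT₀ 0 v f),
    ae_ae_slice₁ (opT₀_ae 0 v f)] with p h1 h2 h3 h4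
  rw [h1, h2, h3, ← integral_const_mul]
  refine integral_congr_ae ?_
  filter_upwards [h4] with s hs
  rw [hs]
  simp only [ContinuousMap.zero_apply]
  ring

theorem commute_opT₀_opT₂ (u : C(I, ℝ)) (k : C(I × I, ℂ)) : Commute (opT₀ u 0) (opT₂ k) := by
  ext1 f
  change opT₀ u 0 (opT₂ k f) = opT₂ k (opT₀ u 0 f)
  apply Lp.ext
  filter_upwards [opT₀_ae u 0 (opT₂ k f), opT₂_ae k f, opT₂_ae k (opT₀ u 0 f),
    ae_ae_slice₂ (opT₀_ae u 0 f)] with p h1 h2 h3 h4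
  rw [h1, h2, h3, ← integral_const_mul]
  refine integral_congr_ae ?_
  filter_upwards [h4] with s hs
  rw [hs]
  simp only [ContinuousMap.zero_apply]
  ring

/-- The kernel `k₁(x,s) k₂(y,t)`. -/
def productKernel (k₁ k₂ : C(I × I, ℂ)) : C((I × I) × (I × I), ℂ) :=
  ⟨fun q => k₁ (q.1.1, q.2.1) * k₂ (q.1.2, q.2.2), by fun_prop⟩

/-- The integral operator on `L₂([0,1]²)` with kernel `k₁(x,s) k₂(y,t)`. -/
def productKernelOp (k₁ k₂ : C(I × I, ℂ)) : L2Sq →L[ℂ] L2Sq :=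
  kernelOp (productKernel k₁ k₂) Prod.snd
    (measurePreserving_snd (μ := (volume : Measure (I × I))) (ν := (volume : Measure (I × I))))

theorem isCompactOperator_productKernelOp (k₁ k₂ : C(I × I, ℂ)) :
    IsCompactOperator (productKernelOp k₁ k₂) :=
  isCompactOperator_kernelOp_snd (productKernel k₁ k₂)

theorem integrable_productKernel_mul (k₁ k₂ : C(I × I, ℂ)) (f : L2Sq) (p : I × I) :
    Integrable (fun q : I × I => k₁ (p.1, q.1) * k₂ (p.2, q.2) * f q) volume :=
  integrable_continuous_mul ((productKernel k₁ k₂).curry p) f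

/-- Fubini turns two partial integrations into one integral operator over the whole square. All
compactness for the three-particle operator comes from here, since a partial integration alone is in
general not compact. -/
theorem opT₁_mul_opT₂ (k₁ k₂ : C(I × I, ℂ)) : opT₁ k₁ * opT₂ k₂ = productKernelOp k₁ k₂ := by
  ext1 f
  change opT₁ k₁ (opT₂ k₂ f) = _
  apply Lp.ext
  filter_upwards [opT₁_ae k₁ (opT₂ k₂ f), ae_ae_slice₁ (opT₂_ae k₂ f),
    kernelOp_ae (productKernel k₁ k₂) Prod.snd
    (measurePreserving_snd (μ := (volume : Measure (I × I))) (ν := (volume : Measure (I × I)))) f]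
    with p h1 h2 h3
  refine h1.trans (Eq.trans ?_ h3.symm)
  refine Eq.trans ?_ (integral_prod _ (integrable_productKernel_mul k₁ k₂ f p)).symm
  refine integral_congr_ae ?_
  filter_upwards [h2] with s hs
  rw [hs, ← integral_const_mul]
  simp only [mul_assoc]

/-- Fubini in the other order gives the same kernel, so the two partial integral operators commute.
-/
theorem opT₂_mul_opT₁ (k₁ k₂ : C(I × I, ℂ)) : opT₂ k₂ * opT₁ k₁ = productKernelOp k₁ k₂ := by
  ext1 f
  change opT₂ k₂ (opT₁ k₁ f) = _
  apply Lp.ext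
  filter_upwards [opT₂_ae k₂ (opT₁ k₁ f), ae_ae_slice₂ (opT₁_ae k₁ f),
    kernelOp_ae (productKernel k₁ k₂) Prod.snd
    (measurePreserving_snd (μ := (volume : Measure (I × I))) (ν := (volume : Measure (I × I)))) f]
    with p h1 h2 h3
  refine h1.trans (Eq.trans ?_ h3.symm)
  refine Eq.trans ?_ (integral_prod_symm _ (integrable_productKernel_mul k₁ k₂ f p)).symm
  refine integral_congr_ae ?_
  filter_upwards [h2] with s hs
  rw [hs, ← integral_const_mul]
  refine integral_congr_ae (Eventually.of_forall fun t => ?_)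
  simp only
  ring

theorem opT_eq_add (u v : C(I, ℝ)) (k₁ k₂ : C(I × I, ℂ)) :
    opT u v k₁ k₂ = (opT₀ u 0 - opT₁ k₁) + (opT₀ 0 v - opT₂ k₂) := by
  have h : opT₀ u v = opT₀ u 0 + opT₀ 0 v := by
    rw [opT₀, opT₀, opT₀, ← mulOp_add]
    congr 1
    ext p
    simp [toComplexMap]
  rw [opT, h]
  abel

theorem friedrichs_sliceLp_fst (u : C(I, ℝ)) (k : C(I × I, ℂ)) (f : L2Sq) :
    ∀ᵐ y : I, friedrichs u k (sliceLp MeasurableEquiv.prodComm f y) =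
      sliceLp MeasurableEquiv.prodComm ((opT₀ u 0 - opT₁ k) f) y := by
  refine friedrichs_sliceLp Measure.measurePreserving_swap (fun f => ?_) f
  refine (Measure.measurePreserving_swap (μ := (volume : Measure I))
    (ν := (volume : Measure I))).quasiMeasurePreserving.ae
    (p := fun p => (opT₀ u 0 - opT₁ k) f p =
      (u p.1 : ℂ) * f p - ∫ s, k (p.1, s) * f (s, p.2)) ?_
  filter_upwards [opT₀_ae u 0 f, opT₁_ae k f, Lp.coeFn_sub (opT₀ u 0 f) (opT₁ k f)] with p h1 h2 h3
  refine h3.trans ?_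
  rw [Pi.sub_apply, h1, h2]
  simp

theorem friedrichs_sliceLp_snd (v : C(I, ℝ)) (k : C(I × I, ℂ)) (f : L2Sq) :
    ∀ᵐ x : I, friedrichs v k (sliceLp (MeasurableEquiv.refl _) f x) =
      sliceLp (MeasurableEquiv.refl _) ((opT₀ 0 v - opT₂ k) f) x := by
  refine friedrichs_sliceLp (MeasurePreserving.id volume) (fun f => ?_) f
  filter_upwards [opT₀_ae 0 v f, opT₂_ae k f, Lp.coeFn_sub (opT₀ 0 v f) (opT₂ k f)] with p h1 h2 h3
  refine h3.trans ?_
  rw [Pi.sub_apply, h1, h2]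
  simp

end TwoVariables

/-! ### Products of functions of one variable -/

section Tensor

theorem memLp_tensor (φ ψ : L2I) :
    MemLp (fun p : I × I => φ p.1 * ψ p.2) 2 (volume : Measure (I × I)) := by
  have hm : AEStronglyMeasurable (fun p : I × I => φ p.1 * ψ p.2) volume :=
    (((Lp.stronglyMeasurable φ).measurable.comp measurable_fst).mul
      ((Lp.stronglyMeasurable ψ).measurable.comp measurable_snd)).aestronglyMeasurable
  rw [memLp_two_iff_integrable_sq_norm hm]
  simp only [norm_mul, mul_pow]
  exact Integrable.mul_prod
    ((memLp_two_iff_integrable_sq_norm (Lp.aestronglyMeasurable φ)).1 (Lp.memLp φ))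
    ((memLp_two_iff_integrable_sq_norm (Lp.aestronglyMeasurable ψ)).1 (Lp.memLp ψ))

/-- The function `(x, y) ↦ φ(x) ψ(y)`. -/
def tensorLp (φ ψ : L2I) : L2Sq := (memLp_tensor φ ψ).toLp _

theorem tensorLp_ae (φ ψ : L2I) : tensorLp φ ψ =ᵐ[volume] fun p => φ p.1 * ψ p.2 :=
  (memLp_tensor φ ψ).coeFn_toLp

theorem norm_tensorLp (φ ψ : L2I) : ‖tensorLp φ ψ‖ = ‖φ‖ * ‖ψ‖ := by
  refine (sq_eq_sq₀ (norm_nonneg _) (by positivity)).1 ?_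
  rw [mul_pow, norm_sq_Lp_two_eq_integral, norm_sq_Lp_two_eq_integral, norm_sq_Lp_two_eq_integral]
  refine Eq.trans (integral_congr_ae ?_) (integral_prod_mul (fun x => ‖φ x‖ ^ 2) fun y => ‖ψ y‖ ^ 2)
  filter_upwards [tensorLp_ae φ ψ] with p hp
  rw [hp, norm_mul, mul_pow]

/-- This identity serves twice: small defects of `φ` and `ψ` give approximate eigenvectors of `T`,
zero defects give eigenvectors. -/
theorem opT_tensorLp_sub (u v : C(I, ℝ)) (k₁ k₂ : C(I × I, ℂ)) (φ ψ : L2I) (α β : ℂ) :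
    opT u v k₁ k₂ (tensorLp φ ψ) - (α + β) • tensorLp φ ψ =
      tensorLp (friedrichs u k₁ φ - α • φ) ψ + tensorLp φ (friedrichs v k₂ ψ - β • ψ) := by
  have hfst : ∀ {P : I → Prop}, (∀ᵐ x, P x) → ∀ᵐ p : I × I, P p.1 := fun h =>
    (measurePreserving_fst (μ := (volume : Measure I))
      (ν := (volume : Measure I))).quasiMeasurePreserving.ae h
  have hsnd : ∀ {P : I → Prop}, (∀ᵐ x, P x) → ∀ᵐ p : I × I, P p.2 := fun h =>
    (measurePreserving_snd (μ := (volume : Measure I))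
      (ν := (volume : Measure I))).quasiMeasurePreserving.ae h
  have hone : ∀ (w : C(I, ℝ)) (k : C(I × I, ℂ)) (χ : L2I) (γ : ℂ), ∀ᵐ x,
      (friedrichs w k χ - γ • χ : L2I) x =
        (w x : ℂ) * χ x - (∫ s, k (x, s) * χ s) - γ * χ x := by
    intro w k χ γ
    filter_upwards [friedrichs_ae w k χ, Lp.coeFn_sub (friedrichs w k χ) (γ • χ),
      Lp.coeFn_smul γ χ] with x h1 h2 h3
    rw [h2, Pi.sub_apply, h1, h3, Pi.smul_apply, smul_eq_mul]
  apply Lp.ext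
  filter_upwards [Lp.coeFn_sub (opT u v k₁ k₂ (tensorLp φ ψ)) ((α + β) • tensorLp φ ψ),
    Lp.coeFn_smul (α + β) (tensorLp φ ψ), tensorLp_ae φ ψ, opT_ae u v k₁ k₂ (tensorLp φ ψ),
    Lp.coeFn_add (tensorLp (friedrichs u k₁ φ - α • φ) ψ)
      (tensorLp φ (friedrichs v k₂ ψ - β • ψ)),
    tensorLp_ae (friedrichs u k₁ φ - α • φ) ψ, tensorLp_ae φ (friedrichs v k₂ ψ - β • ψ),
    hfst (hone u k₁ φ α), hsnd (hone v k₂ ψ β), ae_ae_slice₁ (tensorLp_ae φ ψ),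
    ae_ae_slice₂ (tensorLp_ae φ ψ)] with p h1 h2 h3 h4 h5 h6 h7 h8 h9 h10 h11
  have h12 : ∫ s, k₁ (p.1, s) * tensorLp φ ψ (s, p.2) = (∫ s, k₁ (p.1, s) * φ s) * ψ p.2 := by
    rw [← integral_mul_const]
    refine integral_congr_ae ?_
    filter_upwards [h10] with s hs
    rw [hs, mul_assoc]
  have h13 : ∫ t, k₂ (p.2, t) * tensorLp φ ψ (p.1, t) = φ p.1 * ∫ t, k₂ (p.2, t) * ψ t := by
    rw [← integral_const_mul]
    refine integral_congr_ae ?_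
    filter_upwards [h11] with t ht
    rw [ht]
    ring
  rw [h1, Pi.sub_apply, h2, Pi.smul_apply, h4, h3, h5, Pi.add_apply, h6, h7, h8, h9, h12, h13,
    smul_eq_mul]
  ring

end Tensor


/-! ### Spectra of Friedrichs models -/

section Friedrichs

theorem norm_toComplexMap_le (u : C(I, ℝ)) : ‖toComplexMap u‖ ≤ ‖u‖ :=
  (ContinuousMap.norm_le _ (norm_nonneg u)).2 fun x =>
    (Complex.norm_real (u x)).trans_le (u.norm_coe_le_norm x)

theorem isCompactOperator_integralOp (k : C(I × I, ℂ)) : IsCompactOperator (integralOp k) :=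
  isCompactOperator_kernelOp_snd k

theorem isSelfAdjoint_friedrichs (u : C(I, ℝ)) {k : C(I × I, ℂ)} (hK : (integralOp k).IsPositive) :
    IsSelfAdjoint (friedrichs u k) :=
  (isSelfAdjoint_mulOp_toComplexMap u).sub hK.isSelfAdjoint

theorem range_eq_Icc_norm {u : C(I, ℝ)} (hu : ∀ x, 0 ≤ u x) (hu₀ : ∃ x, u x = 0) :
    range u = Icc 0 ‖u‖ := by
  obtain ⟨x₀, hx₀⟩ := hu₀
  obtain ⟨x₁, hx₁⟩ : ∃ x, u x = ‖u‖ := by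
    obtain ⟨x, -, hx⟩ := isCompact_univ.exists_isMaxOn univ_nonempty u.continuous.continuousOn
    refine ⟨x, le_antisymm ((le_abs_self _).trans (u.norm_coe_le_norm x)) ?_⟩
    refine (ContinuousMap.norm_le _ (hu x)).2 fun y => ?_
    rw [Real.norm_of_nonneg (hu y)]
    exact hx (mem_univ y)
  refine Subset.antisymm ?_ ?_
  · rintro _ ⟨x, rfl⟩
    exact ⟨hu x, (le_abs_self _).trans (u.norm_coe_le_norm x)⟩
  · have h := intermediate_value_univ x₀ x₁ u.continuous
    rwa [hx₀, hx₁] at h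

/-- The bound is by the `L₁` norm, which is much smaller than the `L₂` norm for functions
concentrated on a short interval; such functions are almost annihilated by `K`. -/
theorem norm_integralOp_apply_le (k : C(I × I, ℂ)) (φ : L2I) :
    ‖integralOp k φ‖ ≤ ‖k‖ * ∫ s, ‖φ s‖ := by
  refine (Lp.norm_le_of_ae_bound (C := ‖k‖ * ∫ s, ‖φ s‖) (by positivity) ?_).trans ?_
  · filter_upwards [integralOp_ae k φ] with x hx
    rw [hx]
    exact (norm_integral_continuous_mul_le (k.curry x) φ).trans
      (mul_le_mul_of_nonneg_right (norm_curry_apply_le k x) (by positivity))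
  · simp [measureUnivNNReal]

theorem exists_Icc_near (x : I) {U : Set I} (hU : U ∈ 𝓝 x) {ε : ℝ} (hε : 0 < ε) :
    ∃ y z : I, y < z ∧ (z : ℝ) - y ≤ ε ∧ Icc y z ⊆ U := by
  obtain ⟨r, hr, hrU⟩ := Metric.mem_nhds_iff.1 hU
  set d := min (min (r / 2) (ε / 2)) (1 / 2)
  have hd : 0 < d := by positivity
  have hd1 : d ≤ r / 2 := (min_le_left _ _).trans (min_le_left _ _)
  have hd2 : d ≤ ε / 2 := (min_le_left _ _).trans (min_le_right _ _)
  have hd3 : d ≤ 1 / 2 := min_le_right _ _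
  have hx := x.2
  refine ⟨⟨max (x - d) 0, by simp, max_le (by linarith [hx.2]) zero_le_one⟩,
    ⟨min (x + d) 1, le_min (by linarith [hx.1]) zero_le_one, by simp⟩, ?_, ?_, ?_⟩
  · rw [← Subtype.coe_lt_coe]
    exact max_lt (lt_min (by linarith) (by linarith [hx.2])) (lt_min (by linarith [hx.1]) one_pos)
  · change min _ _ - max _ _ ≤ ε
    linarith [min_le_left ((x : ℝ) + d) 1, le_max_left ((x : ℝ) - d) 0]
  · intro s hs
    refine hrU ?_
    have h1 : max ((x : ℝ) - d) 0 ≤ s := hs.1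
    have h2 : (s : ℝ) ≤ min ((x : ℝ) + d) 1 := hs.2
    rw [Metric.mem_ball, Subtype.dist_eq, Real.dist_eq, abs_lt]
    constructor <;> linarith [le_max_left ((x : ℝ) - d) 0, min_le_left ((x : ℝ) + d) 1]

/-- The values of `u` belong to the spectrum of the Friedrichs model. -/
theorem apply_mem_realSpectrum_friedrichs (u : C(I, ℝ)) {k : C(I × I, ℂ)}
    (hK : (integralOp k).IsPositive) (x : I) : u x ∈ realSpectrum (friedrichs u k) := by
  rw [mem_realSpectrum_iff (isSelfAdjoint_friedrichs u hK)]
  intro c hc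
  -- The trial function is the indicator of a short interval near `x`. The oscillation of `u` costs
  -- `c / 2`. The integral term costs `‖k‖ √(z - y) ≤ c / 4`, which dictates the length; the `+ 1`
  -- covers `k = 0`.
  obtain ⟨y, z, hyz, hzε, hJ⟩ := exists_Icc_near x
    (Metric.tendsto_nhds.1 (u.continuous.tendsto x) (c / 2) (by positivity))
    (ε := (c / (4 * (‖k‖ + 1))) ^ 2) (by positivity)
  have hyz' : (0 : ℝ) < z - y := sub_pos.2 hyz
  set φ : L2I := indicatorConstLp 2 (measurableSet_Icc (a := y) (b := z))
    (measure_ne_top volume _) (1 : ℂ)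
  have hφ : φ =ᵐ[volume] (Icc y z).indicator fun _ => (1 : ℂ) := indicatorConstLp_coeFn
  have hvol : (volume : Measure I).real (Icc y z) = z - y := by
    rw [measureReal_def, unitInterval.volume_Icc, ENNReal.toReal_ofReal hyz'.le]
  have hφn : ‖φ‖ = √(z - y) := by
    rw [norm_indicatorConstLp (by norm_num) (by norm_num), hvol, norm_one, one_mul,
      Real.sqrt_eq_rpow]
    norm_num
  have hφ1 : ∫ s, ‖φ s‖ = z - y := by
    rw [← hvol, ← integral_indicator_one (measurableSet_Icc (a := y) (b := z))]
    refine integral_congr_ae ?_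
    filter_upwards [hφ] with s hs
    rw [hs, norm_indicator_eq_indicator_norm]
    simp [indicator]
  have hmul : ‖mulOp (toComplexMap u) φ - (u x : ℂ) • φ‖ ≤ c / 2 * ‖φ‖ := by
    refine Lp.norm_le_mul_norm_of_ae_le_mul ?_
    filter_upwards [mulOp_ae (toComplexMap u) φ, hφ, Lp.coeFn_smul (u x : ℂ) φ,
      Lp.coeFn_sub (mulOp (toComplexMap u) φ) ((u x : ℂ) • φ)] with s h1 h2 h3 h4
    rw [h4, Pi.sub_apply, h1, h3, Pi.smul_apply, smul_eq_mul, ← sub_mul, norm_mul]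
    by_cases hs : s ∈ Icc y z
    · have h5 : dist (u s) (u x) < c / 2 := hJ hs
      refine mul_le_mul_of_nonneg_right ?_ (norm_nonneg _)
      rw [Real.dist_eq] at h5
      change ‖((u s : ℝ) : ℂ) - u x‖ ≤ _
      rw [← Complex.ofReal_sub, Complex.norm_real]
      exact h5.le
    · rw [h2, indicator_of_notMem hs]
      simp
  have hsq : √(z - y) ≤ c / (4 * (‖k‖ + 1)) := Real.sqrt_le_iff.2 ⟨by positivity, hzε⟩
  have hk : ‖integralOp k φ‖ ≤ c / 4 * ‖φ‖ := by
    refine (norm_integralOp_apply_le k φ).trans ?_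
    rw [hφ1, hφn]
    have h1 : ‖k‖ * √(z - y) ≤ c / 4 := by
      rw [le_div_iff₀ (by positivity)] at hsq
      nlinarith [Real.sqrt_nonneg ((z : ℝ) - y)]
    calc ‖k‖ * ((z : ℝ) - y) = ‖k‖ * √(z - y) * √(z - y) := by
          rw [mul_assoc, Real.mul_self_sqrt hyz'.le]
      _ ≤ _ := mul_le_mul_of_nonneg_right h1 (Real.sqrt_nonneg _)
  have hpos : 0 < ‖φ‖ := by rw [hφn]; exact Real.sqrt_pos.2 hyz'
  refine ⟨φ, ?_⟩
  have h1 : friedrichs u k φ - (u x : ℂ) • φ =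
      (mulOp (toComplexMap u) φ - (u x : ℂ) • φ) - integralOp k φ := by
    change (mulOp (toComplexMap u) φ - integralOp k φ) - (u x : ℂ) • φ = _
    abel
  rw [h1]
  refine (norm_sub_le _ _).trans_lt ?_
  nlinarith

/-- Subtracting `K ≥ 0` only lowers the quadratic form, so `⟪(t - H) φ, φ⟫` is at least `(t - ‖u‖)
‖φ‖²`, which excludes approximate eigenvectors for `t > ‖u‖`. -/
theorem le_norm_of_mem_realSpectrum_friedrichs (u : C(I, ℝ)) {k : C(I × I, ℂ)}
    (hK : (integralOp k).IsPositive) {t : ℝ} (ht : t ∈ realSpectrum (friedrichs u k)) :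
    t ≤ ‖u‖ := by
  by_contra! hlt
  obtain ⟨φ, hφ⟩ := (mem_realSpectrum_iff (isSelfAdjoint_friedrichs u hK) t).1 ht (t - ‖u‖)
    (sub_pos.2 hlt)
  have h1 : RCLike.re (inner ℂ ((t : ℂ) • φ - friedrichs u k φ) φ) ≤
      ‖friedrichs u k φ - (t : ℂ) • φ‖ * ‖φ‖ := by
    rw [norm_sub_rev]
    exact (RCLike.re_le_norm _).trans (norm_inner_le_norm _ _)
  have h2 : inner ℂ ((t : ℂ) • φ - friedrichs u k φ) φ =
      t * inner ℂ φ φ - inner ℂ (mulOp (toComplexMap u) φ) φ + inner ℂ (integralOp k φ) φ := by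
    change inner ℂ ((t : ℂ) • φ - (mulOp (toComplexMap u) φ - integralOp k φ)) φ = _
    rw [inner_sub_left, inner_sub_left, inner_smul_left, Complex.conj_ofReal]
    ring
  have h3 : RCLike.re ((t : ℂ) * inner ℂ φ φ) = t * ‖φ‖ ^ 2 := by
    rw [← inner_self_eq_norm_sq (𝕜 := ℂ) φ]
    exact Complex.re_ofReal_mul _ _
  have h4 : RCLike.re (inner ℂ (mulOp (toComplexMap u) φ) φ) ≤ ‖u‖ * ‖φ‖ ^ 2 := by
    refine (RCLike.re_le_norm _).trans ((norm_inner_le_norm _ _).trans ?_)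
    have h5 := (norm_mulOp_apply_le (toComplexMap u) φ).trans
      (mul_le_mul_of_nonneg_right (norm_toComplexMap_le u) (norm_nonneg φ))
    nlinarith [norm_nonneg φ]
  have h6 : 0 ≤ RCLike.re (inner ℂ (integralOp k φ) φ) := hK.re_inner_nonneg_left φ
  rw [h2, map_add, map_sub, h3] at h1
  have hpos : 0 < ‖φ‖ := by
    by_contra! h0
    rw [le_antisymm h0 (norm_nonneg φ), mul_zero] at hφ
    exact absurd hφ (not_lt.2 (norm_nonneg _))
  nlinarith

/-- Outside of the range of `u`, the spectrum of the Friedrichs model is discrete. -/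
theorem mem_discreteSpectrum_friedrichs (u : C(I, ℝ)) {k : C(I × I, ℂ)}
    (hK : (integralOp k).IsPositive) {t : ℝ} (ht : t ∈ realSpectrum (friedrichs u k))
    (htu : t ∉ range u) : t ∈ discreteSpectrum (friedrichs u k) := by
  have htU : t ∉ realSpectrum (mulOp (toComplexMap u)) := fun h =>
    htu (mem_range_of_mem_realSpectrum_mulOp h)
  rw [mem_realSpectrum_iff (isSelfAdjoint_mulOp_toComplexMap u)] at htU
  push Not at htU
  obtain ⟨c, hc, hcU⟩ := htU
  have hcomp : IsCompactOperator (((c⁻¹ : ℝ) : ℂ) • integralOp k) :=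
    IsCompactOperator.smul (S := ℂ) (isCompactOperator_integralOp k) ((c⁻¹ : ℝ) : ℂ)
  refine mem_discreteSpectrum_of_compact_estimate (isSelfAdjoint_friedrichs u hK)
    hcomp (C := c⁻¹) (fun φ => ?_) ht
  have h1 : mulOp (toComplexMap u) φ - (t : ℂ) • φ =
      (friedrichs u k φ - (t : ℂ) • φ) + integralOp k φ := by
    change _ = ((mulOp (toComplexMap u) φ - integralOp k φ) - (t : ℂ) • φ) + integralOp k φ
    abel
  have h2 : ‖(((c⁻¹ : ℝ) : ℂ) • integralOp k) φ‖ = c⁻¹ * ‖integralOp k φ‖ := by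
    change ‖((c⁻¹ : ℝ) : ℂ) • integralOp k φ‖ = _
    rw [norm_smul, Complex.norm_real, Real.norm_of_nonneg (inv_nonneg.2 hc.le)]
  rw [h2, ← mul_add, inv_mul_eq_div, le_div_iff₀ hc, mul_comm]
  refine (hcU φ).trans ?_
  rw [h1]
  exact norm_add_le _ _

end Friedrichs

/-! ### The spectrum of the three-particle operator -/

section ThreeParticle

variable {u v : C(I, ℝ)} {k₁ k₂ : C(I × I, ℂ)}

theorem isSelfAdjoint_opT (hK₁ : (integralOp k₁).IsPositive) (hK₂ : (integralOp k₂).IsPositive) :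
    IsSelfAdjoint (opT u v k₁ k₂) := by
  rw [opT_eq_add]
  exact (isSelfAdjoint_of_sliceLp Measure.measurePreserving_swap (isSelfAdjoint_friedrichs u hK₁)
      (friedrichs_sliceLp_fst u k₁)).add
    (isSelfAdjoint_of_sliceLp (MeasurePreserving.id volume) (isSelfAdjoint_friedrichs v hK₂)
      (friedrichs_sliceLp_snd v k₂))

theorem add_mem_realSpectrum_opT (hK₁ : (integralOp k₁).IsPositive)
    (hK₂ : (integralOp k₂).IsPositive) {α β : ℝ} (hα : α ∈ realSpectrum (friedrichs u k₁))
    (hβ : β ∈ realSpectrum (friedrichs v k₂)) : α + β ∈ realSpectrum (opT u v k₁ k₂) := by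
  rw [mem_realSpectrum_iff (isSelfAdjoint_opT hK₁ hK₂)]
  intro c hc
  obtain ⟨φ, hφ1, hφ⟩ := exists_unit_approx_eigenvector (isSelfAdjoint_friedrichs u hK₁) hα
    (half_pos hc)
  obtain ⟨ψ, hψ1, hψ⟩ := exists_unit_approx_eigenvector (isSelfAdjoint_friedrichs v hK₂) hβ
    (half_pos hc)
  refine ⟨tensorLp φ ψ, ?_⟩
  rw [Complex.ofReal_add, opT_tensorLp_sub]
  refine (norm_add_le _ _).trans_lt ?_
  rw [norm_tensorLp, norm_tensorLp, norm_tensorLp, hφ1, hψ1]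
  linarith

theorem isEigenvalue_opT_add {α β : ℝ} (hα : IsEigenvalue (friedrichs u k₁) α)
    (hβ : IsEigenvalue (friedrichs v k₂) β) : IsEigenvalue (opT u v k₁ k₂) (α + β) := by
  obtain ⟨φ, hφ, hφ0⟩ := Module.End.HasEigenvalue.exists_hasEigenvector hα
  obtain ⟨ψ, hψ, hψ0⟩ := Module.End.HasEigenvalue.exists_hasEigenvector hβ
  have hφ' : friedrichs u k₁ φ - (α : ℂ) • φ = 0 :=
    sub_eq_zero.2 (Module.End.mem_eigenspace_iff.1 hφ)
  have hψ' : friedrichs v k₂ ψ - (β : ℂ) • ψ = 0 :=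
    sub_eq_zero.2 (Module.End.mem_eigenspace_iff.1 hψ)
  have h := opT_tensorLp_sub u v k₁ k₂ φ ψ α β
  have h0 : ∀ χ : L2I, tensorLp 0 χ = 0 ∧ tensorLp χ 0 = 0 := fun χ =>
    ⟨norm_eq_zero.1 (by simp [norm_tensorLp]), norm_eq_zero.1 (by simp [norm_tensorLp])⟩
  rw [hφ', hψ', (h0 ψ).1, (h0 φ).2, add_zero, sub_eq_zero, ← Complex.ofReal_add] at h
  refine Module.End.hasEigenvalue_of_hasEigenvector (x := tensorLp φ ψ)
    ⟨Module.End.mem_eigenspace_iff.2 h, fun h1 => ?_⟩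
  have h2 := norm_tensorLp φ ψ
  rw [h1, norm_zero] at h2
  exact (mul_pos (norm_pos_iff.2 hφ0) (norm_pos_iff.2 hψ0)).ne h2

/-- Points of the essential spectrum of the three-particle operator are sums of points of the
spectra of the Friedrichs models which are not both negative. -/
theorem exists_add_eq_of_mem_essentialSpectrum_opT (hu : ∀ x, 0 ≤ u x) (hv : ∀ x, 0 ≤ v x)
    (hK₁ : (integralOp k₁).IsPositive) (hK₂ : (integralOp k₂).IsPositive) {t : ℝ}
    (ht : t ∈ essentialSpectrum (opT u v k₁ k₂)) :
    ∃ α ∈ realSpectrum (friedrichs u k₁), ∃ β ∈ realSpectrum (friedrichs v k₂),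
      α + β = t ∧ (0 ≤ α ∨ 0 ≤ β) := by
  obtain ⟨ht, htd⟩ := ht
  by_contra! hcon
  refine htd ?_
  rw [opT_eq_add] at ht ⊢
  have hne : ∀ w : C(I × I, ℝ), (∀ p, 0 ≤ w p) →
      ∀ s ∈ realSpectrum (mulOp (toComplexMap w)), 0 ≤ s := by
    intro w hw s hs
    obtain ⟨p, rfl⟩ := mem_range_of_mem_realSpectrum_mulOp hs
    exact hw p
  have hc12 : Commute (opT₁ k₁) (opT₂ k₂) := (opT₁_mul_opT₂ k₁ k₂).trans (opT₂_mul_opT₁ k₁ k₂).symm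
  have hUV : Commute (opT₀ u 0) (opT₀ 0 v) := commute_mulOp _ _
  have hAV : Commute (opT₀ u 0 - opT₁ k₁) (opT₀ 0 v) :=
    hUV.sub_left (commute_opT₀_opT₁ v k₁).symm
  -- Here `A = H₁ ⊗ E` and `B = E ⊗ H₂` perturb multiplication by `u(x)` and by `v(y)`, and `(U - A)
  -- (V - B)` is `opT₁ k₁ * opT₂ k₂`.
  refine mem_discreteSpectrum_add_of_isCompactOperator (U := opT₀ u 0) (V := opT₀ 0 v)
    (isSelfAdjoint_of_sliceLp Measure.measurePreserving_swap (isSelfAdjoint_friedrichs u hK₁)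
      (friedrichs_sliceLp_fst u k₁)) (isSelfAdjoint_mulOp_toComplexMap _)
    (isSelfAdjoint_of_sliceLp (MeasurePreserving.id volume) (isSelfAdjoint_friedrichs v hK₂)
      (friedrichs_sliceLp_snd v k₂)) (isSelfAdjoint_mulOp_toComplexMap _)
    (hAV.sub_right ((commute_opT₀_opT₂ u k₂).sub_left hc12)) ?_ hAV ?_
    (hne _ fun p => ?_) (hne _ fun p => ?_) (fun α hα β hβ h => ?_) ht
  · rw [sub_sub_cancel]
    exact commute_opT₀_opT₂ u k₂
  · rw [sub_sub_cancel, sub_sub_cancel, opT₁_mul_opT₂]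
    exact isCompactOperator_productKernelOp k₁ k₂
  · simpa using hu p.1
  · simpa using hv p.2
  · exact hcon α (realSpectrum_subset_of_sliceLp Measure.measurePreserving_swap
      (isSelfAdjoint_friedrichs u hK₁) (friedrichs_sliceLp_fst u k₁) hα) β
      (realSpectrum_subset_of_sliceLp (MeasurePreserving.id volume)
      (isSelfAdjoint_friedrichs v hK₂) (friedrichs_sliceLp_snd v k₂) hβ) h

end ThreeParticle


/-! ### Segment decompositions -/

section Segments

/-- The other segments form a closed set that misses `S k`. -/
theorem IsSegmentDecomposition.exists_forall_dist_lt {X : Set ℝ} {n : ℕ} {S S' : Fin n → ℝ}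
    (h : IsSegmentDecomposition X n S S') (k : Fin n) :
    ∃ δ > 0, ∀ s ∈ X, |s - S k| < δ → s ∈ Icc (S k) (S' k) := by
  obtain ⟨hX, hle, hlt⟩ := h
  have hcl : IsClosed (⋃ j ∈ {j : Fin n | j ≠ k}, Icc (S j) (S' j)) :=
    (Set.toFinite _).isClosed_biUnion fun j _ => isClosed_Icc
  have hk : S k ∉ ⋃ j ∈ {j : Fin n | j ≠ k}, Icc (S j) (S' j) := by
    simp only [mem_iUnion, not_exists]
    intro j hj hmem
    rcases lt_or_gt_of_ne (show j ≠ k from hj) with hjk | hjk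
    · exact absurd hmem.2 (not_le.2 (hlt j k hjk))
    · exact absurd hmem.1 (not_le.2 ((hle k).trans_lt (hlt k j hjk)))
  obtain ⟨δ, hδ, hball⟩ := Metric.isOpen_iff.1 hcl.isOpen_compl _ hk
  refine ⟨δ, hδ, fun s hs hsd => ?_⟩
  rw [hX, mem_iUnion] at hs
  obtain ⟨j, hj⟩ := hs
  by_cases hjk : j = k
  · exact hjk ▸ hj
  · exact absurd (mem_biUnion (show j ∈ {j : Fin n | j ≠ k} from hjk) hj) (hball hsd)

theorem IsSegmentDecomposition.left_mem {X : Set ℝ} {n : ℕ} {S S' : Fin n → ℝ}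
    (h : IsSegmentDecomposition X n S S') (k : Fin n) : S k ∈ X := by
  rw [h.1]
  exact mem_iUnion.2 ⟨k, left_mem_Icc.2 (h.2.1 k)⟩

/-- Disjoint segments are determined by their left endpoints, so listing these in increasing order
numbers the segments. -/
theorem exists_isSegmentDecomposition_of_disjoint (F : Finset (ℝ × ℝ)) (hF : ∀ p ∈ F, p.1 ≤ p.2)
    (hd : ∀ p ∈ F, ∀ q ∈ F, p ≠ q → p.2 < q.1 ∨ q.2 < p.1) :
    ∃ (n : ℕ) (S S' : Fin n → ℝ), IsSegmentDecomposition (⋃ p ∈ F, Icc p.1 p.2) n S S' := by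
  set G := F.image Prod.fst
  set S := G.orderEmbOfFin rfl
  have hS : ∀ k, ∃ p ∈ F, p.1 = S k := fun k =>
    Finset.mem_image.1 (G.orderEmbOfFin_mem rfl k)
  choose P hPF hP using hS
  refine ⟨G.card, S, fun k => (P k).2, ?_, fun k => ?_, fun i j hij => ?_⟩
  · ext t
    simp only [mem_iUnion]
    constructor
    · rintro ⟨p, hp, ht⟩
      obtain ⟨k, hk⟩ : ∃ k, S k = p.1 := by
        have h1 : p.1 ∈ Set.range S := by
          rw [Finset.range_orderEmbOfFin]
          exact Finset.mem_coe.2 (Finset.mem_image_of_mem _ hp)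
        exact h1
      have hpk : P k = p := by
        by_contra hne
        have h1 := hF p hp
        have h2 := hF _ (hPF k)
        have h3 := hP k
        rcases hd _ (hPF k) p hp hne with h | h <;> linarith
      refine ⟨k, ?_⟩
      rw [hpk, hk]
      exact ht
    · rintro ⟨k, hk⟩
      exact ⟨P k, hPF k, by rwa [hP k]⟩
  · rw [← hP k]
    exact hF _ (hPF k)
  · have hlt : S i < S j := S.strictMono hij
    rw [← hP i, ← hP j] at hlt
    have h2 := hF _ (hPF j)
    rw [← hP j]
    rcases hd _ (hPF i) _ (hPF j) (fun h => hlt.ne (by rw [h])) with h | h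
    · exact h
    · linarith

/-- A finite union of closed segments is a union of finitely many disjoint closed segments. -/
theorem exists_isSegmentDecomposition (F : Finset (ℝ × ℝ)) (hF : ∀ p ∈ F, p.1 ≤ p.2) :
    ∃ (n : ℕ) (S S' : Fin n → ℝ), IsSegmentDecomposition (⋃ p ∈ F, Icc p.1 p.2) n S S' := by
  induction hc : F.card using Nat.strong_induction_on generalizing F with
  | _ m ih =>
    by_cases hd : ∀ p ∈ F, ∀ q ∈ F, p ≠ q → p.2 < q.1 ∨ q.2 < p.1
    · exact exists_isSegmentDecomposition_of_disjoint F hF hd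
    · push Not at hd
      obtain ⟨p, hp, q, hq, hpq, h1, h2⟩ := hd
      have hqp : q ∈ F.erase p := Finset.mem_erase.2 ⟨hpq.symm, hq⟩
      set F₀ := (F.erase p).erase q
      have hFi : F = insert p (insert q F₀) := by
        rw [Finset.insert_erase hqp, Finset.insert_erase hp]
      -- Two segments that meet are replaced by their union, which lowers the number of segments.
      set r : ℝ × ℝ := (min p.1 q.1, max p.2 q.2)
      have hu : ⋃ p ∈ F, Icc p.1 p.2 = ⋃ p ∈ insert r F₀, Icc p.1 p.2 := by
        rw [hFi, Finset.set_biUnion_insert, Finset.set_biUnion_insert, Finset.set_biUnion_insert,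
          ← union_assoc, Icc_union_Icc' h1 h2]
      have hcard : (insert r F₀).card < m := by
        have h3 := Finset.card_erase_add_one hp
        have h4 : F₀.card + 1 = (F.erase p).card := Finset.card_erase_add_one hqp
        have h5 := Finset.card_insert_le r F₀
        omega
      rw [hu]
      refine ih _ hcard (insert r F₀) (fun s hs => ?_) rfl
      rcases Finset.mem_insert.1 hs with rfl | hs
      · exact (min_le_left _ _).trans ((hF p hp).trans (le_max_left _ _))
      · exact hF s (Finset.mem_of_mem_erase (Finset.mem_of_mem_erase hs))

end Segments

/-! ### Sums of spectra -/

section SumOfSpectra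

/-- The shape of the spectrum of a Friedrichs model with infinitely many negative eigenvalues: the
segment `[0, a]` and a sequence of negative points increasing to `0`. -/
structure IsFriedrichsSpectrum (A : Set ℝ) (a : ℝ) : Prop where
  nonneg : 0 ≤ a
  Icc_subset : Icc 0 a ⊆ A
  le : ∀ s ∈ A, s ≤ a
  finite : ∀ c < 0, (A ∩ Iic c).Finite
  exists_neg : ∀ ε > 0, ∃ s ∈ A, -ε < s ∧ s < 0

/-- Sums of a point of `A` and a point of `B` which are not both negative. -/
def sumNotBothNeg (A B : Set ℝ) : Set ℝ :=
  {t | ∃ α ∈ A, ∃ β ∈ B, α + β = t ∧ (0 ≤ α ∨ 0 ≤ β)}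

variable {A B : Set ℝ} {a b : ℝ}

theorem sumNotBothNeg_comm (A B : Set ℝ) : sumNotBothNeg A B = sumNotBothNeg B A := by
  ext t
  constructor <;>
  · rintro ⟨α, hα, β, hβ, h, h'⟩
    exact ⟨β, hβ, α, hα, by rw [add_comm, h], h'.symm⟩

namespace IsFriedrichsSpectrum

/-- A positive point can be lowered inside `[0, a]`, and `0` is a limit of negative points of `A`,
even when `a = 0`. -/
theorem exists_ne_near (hA : IsFriedrichsSpectrum A a) {α : ℝ} (hα : α ∈ A) (h0 : 0 ≤ α) {δ : ℝ}
    (hδ : 0 < δ) : ∃ s ∈ A, s ≠ α ∧ |s - α| < δ := by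
  rcases h0.eq_or_lt with rfl | h0
  · obtain ⟨s, hs, h1, h2⟩ := hA.exists_neg δ hδ
    exact ⟨s, hs, h2.ne, abs_lt.2 ⟨by linarith, by linarith⟩⟩
  · set d := min (δ / 2) α
    have hd : 0 < d := by positivity
    have h1 : d ≤ δ / 2 := min_le_left _ _
    have h2 : d ≤ α := min_le_right _ _
    have h3 := hA.le α hα
    exact ⟨α - d, hA.Icc_subset ⟨by linarith, by linarith⟩, by linarith,
      abs_lt.2 ⟨by linarith, by linarith⟩⟩

/-- The nearby sum is only claimed to lie in `A + B`: that is enough to show that `t` is not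
isolated in the full spectrum of `T`. -/
theorem exists_add_ne_near (hA : IsFriedrichsSpectrum A a) (hB : IsFriedrichsSpectrum B b)
    {t : ℝ} (ht : t ∈ sumNotBothNeg A B) {δ : ℝ} (hδ : 0 < δ) :
    ∃ α ∈ A, ∃ β ∈ B, α + β ≠ t ∧ |α + β - t| < δ := by
  obtain ⟨α, hα, β, hβ, rfl, h | h⟩ := ht
  · obtain ⟨s, hs, h1, h2⟩ := hA.exists_ne_near hα h hδ
    exact ⟨s, hs, β, hβ, fun h3 => h1 (add_right_cancel h3), by rwa [add_sub_add_right_eq_sub]⟩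
  · obtain ⟨s, hs, h1, h2⟩ := hB.exists_ne_near hβ h hδ
    exact ⟨α, hα, s, hs, fun h3 => h1 (add_left_cancel h3), by rwa [add_sub_add_left_eq_sub]⟩

/-- Adding the segment `[0, a]` of `A` to a point of `B` stays in the sum. -/
theorem add_Icc_subset (hA : IsFriedrichsSpectrum A a) {β : ℝ} (hβ : β ∈ B) :
    Icc β (β + a) ⊆ sumNotBothNeg A B := fun t ht =>
  ⟨t - β, hA.Icc_subset ⟨by linarith [ht.1], by linarith [ht.2]⟩, β, hβ, by ring,
    Or.inl (by linarith [ht.1])⟩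

/-- In contrast with `exists_add_ne_near`, the neighbour must stay in the sum itself, so the shift
has to take place inside `[0, a]`, which needs `a > 0`. -/
theorem exists_ne_near_of_pos (hA : IsFriedrichsSpectrum A a) (ha : 0 < a) {α β : ℝ} (hα : α ∈ A)
    (hβ : β ∈ B) (h0 : 0 ≤ α) {δ : ℝ} (hδ : 0 < δ) :
    ∃ s ∈ sumNotBothNeg A B, s ≠ α + β ∧ |s - (α + β)| < δ := by
  have h3 := hA.le α hα
  rcases h0.eq_or_lt with rfl | h0
  · set d := min (δ / 2) a
    have hd : 0 < d := by positivity
    have h1 : d ≤ δ / 2 := min_le_left _ _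
    have h2 : d ≤ a := min_le_right _ _
    exact ⟨β + d, hA.add_Icc_subset hβ ⟨by linarith, by linarith⟩,
      by intro h; linarith, abs_lt.2 ⟨by linarith, by linarith⟩⟩
  · set d := min (δ / 2) α
    have hd : 0 < d := by positivity
    have h1 : d ≤ δ / 2 := min_le_left _ _
    have h2 : d ≤ α := min_le_right _ _
    exact ⟨α + β - d, hA.add_Icc_subset hβ ⟨by linarith, by linarith⟩, by linarith,
      abs_lt.2 ⟨by linarith, by linarith⟩⟩

theorem sumNotBothNeg_not_isolated (hA : IsFriedrichsSpectrum A a) (hB : IsFriedrichsSpectrum B b)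
    (ha : 0 < a) (hb : 0 < b) {t : ℝ} (ht : t ∈ sumNotBothNeg A B) {δ : ℝ} (hδ : 0 < δ) :
    ∃ s ∈ sumNotBothNeg A B, s ≠ t ∧ |s - t| < δ := by
  obtain ⟨α, hα, β, hβ, rfl, h | h⟩ := ht
  · exact hA.exists_ne_near_of_pos ha hα hβ h hδ
  · rw [sumNotBothNeg_comm, add_comm]
    exact hB.exists_ne_near_of_pos hb hβ hα h hδ

/-- A positive `α` could be lowered inside `[0, a]`, so `α = 0`. A nonnegative `β` could be lowered
inside `B`, keeping `0` as the other summand, so `β < 0`. -/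
theorem left_endpoint_aux (hA : IsFriedrichsSpectrum A a) (hB : IsFriedrichsSpectrum B b)
    {α β δ : ℝ} (hα : α ∈ A) (hβ : β ∈ B) (h0 : 0 ≤ α) (hδ : 0 < δ)
    (hiso : ∀ s ∈ sumNotBothNeg A B, |s - (α + β)| < δ → α + β ≤ s) :
    α + β ∈ B ∧ α + β < 0 := by
  have hα0 : α = 0 := by
    by_contra hne
    have hpos : 0 < α := lt_of_le_of_ne h0 (Ne.symm hne)
    set d := min (δ / 2) α
    have hd : 0 < d := by positivity
    have h1 : d ≤ δ / 2 := min_le_left _ _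
    have h2 : d ≤ α := min_le_right _ _
    have := hiso (α + β - d) (hA.add_Icc_subset hβ
      ⟨by linarith, by linarith [hA.le α hα]⟩) (abs_lt.2 ⟨by linarith, by linarith⟩)
    linarith
  subst hα0
  rw [zero_add] at hiso ⊢
  refine ⟨hβ, ?_⟩
  by_contra! hβ0
  obtain ⟨s, hs, hne, hsd⟩ : ∃ s ∈ B, s < β ∧ |s - β| < δ := by
    rcases hβ0.eq_or_lt with rfl | hβ0
    · obtain ⟨s, hs, h1, h2⟩ := hB.exists_neg δ hδ
      exact ⟨s, hs, h2, abs_lt.2 ⟨by linarith, by linarith⟩⟩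
    · set d := min (δ / 2) β
      have hd : 0 < d := by positivity
      have h1 : d ≤ δ / 2 := min_le_left _ _
      have h2 : d ≤ β := min_le_right _ _
      exact ⟨β - d, hB.Icc_subset ⟨by linarith, by linarith [hB.le β hβ]⟩, by linarith,
        abs_lt.2 ⟨by linarith, by linarith⟩⟩
  exact absurd (hiso s (hA.add_Icc_subset hs (left_mem_Icc.2 (by linarith [hA.nonneg]))) hsd)
    (not_le.2 hne)

/-- Points of the sum which are isolated from the left are negative points of `A` or `B`. -/
theorem left_endpoint (hA : IsFriedrichsSpectrum A a) (hB : IsFriedrichsSpectrum B b) {t δ : ℝ}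
    (ht : t ∈ sumNotBothNeg A B) (hδ : 0 < δ)
    (hiso : ∀ s ∈ sumNotBothNeg A B, |s - t| < δ → t ≤ s) : (t ∈ A ∨ t ∈ B) ∧ t < 0 := by
  obtain ⟨α, hα, β, hβ, rfl, h | h⟩ := ht
  · exact (hA.left_endpoint_aux hB hα hβ h hδ hiso).imp_left Or.inr
  · rw [add_comm] at hiso ⊢
    rw [sumNotBothNeg_comm] at hiso
    exact (hB.left_endpoint_aux hA hβ hα h hδ hiso).imp_left Or.inl

/-- A negative `β ∈ B` with `β > -a` gives a segment `[β, β + a]` that extends past `0`; the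
translates of `[0, a]` by the points of `[0, b]` cover the rest. -/
theorem exists_Icc_subset (hA : IsFriedrichsSpectrum A a) (hB : IsFriedrichsSpectrum B b)
    (ha : 0 < a) : ∃ c < 0, Icc c (a + b) ⊆ sumNotBothNeg A B := by
  obtain ⟨β, hβ, h1, h2⟩ := hB.exists_neg a ha
  refine ⟨β, h2, fun t ht => ?_⟩
  rcases le_or_gt t (β + a) with h | h
  · exact hA.add_Icc_subset hβ ⟨ht.1, h⟩
  · rcases le_or_gt t b with h3 | h3
    · exact hA.add_Icc_subset (hB.Icc_subset ⟨by linarith, h3⟩) ⟨le_rfl, by linarith⟩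
    · exact hA.add_Icc_subset (hB.Icc_subset ⟨hB.nonneg, le_rfl⟩) ⟨h3.le, by linarith [ht.2]⟩

theorem exists_isSegmentDecomposition (hA : IsFriedrichsSpectrum A a)
    (hB : IsFriedrichsSpectrum B b) (hab : 0 < a ∨ 0 < b) :
    ∃ (n : ℕ) (S S' : Fin n → ℝ), IsSegmentDecomposition (sumNotBothNeg A B) n S S' := by
  obtain ⟨c, hc, hcX⟩ : ∃ c < 0, Icc c (a + b) ⊆ sumNotBothNeg A B := by
    rcases hab with h | h
    · exact hA.exists_Icc_subset hB h
    · rw [add_comm, sumNotBothNeg_comm]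
      exact hB.exists_Icc_subset hA h
  classical
  -- A sum below `c` with one summand nonnegative has the other below `c`, which leaves finitely
  -- many segments besides `[c, a + b]`.
  set F : Finset (ℝ × ℝ) := insert (c, a + b)
    ((hB.finite c hc).toFinset.image (fun β => (β, β + a)) ∪
      (hA.finite c hc).toFinset.image fun α => (α, α + b))
  have hF : ∀ p ∈ F, p.1 ≤ p.2 := by
    intro p hp
    have h1 := hA.nonneg
    have h2 := hB.nonneg
    simp only [F, Finset.mem_insert, Finset.mem_union, Finset.mem_image] at hp
    rcases hp with rfl | ⟨β, -, rfl⟩ | ⟨α, -, rfl⟩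
    · change c ≤ a + b
      linarith
    · change β ≤ β + a
      linarith
    · change α ≤ α + b
      linarith
  have hX : sumNotBothNeg A B = ⋃ p ∈ F, Icc p.1 p.2 := by
    ext t
    simp only [mem_iUnion, exists_prop]
    constructor
    · rintro ⟨α, hα, β, hβ, rfl, h⟩
      have h1 := hA.le α hα
      have h2 := hB.le β hβ
      rcases lt_or_ge (α + β) c with h3 | h3
      · rcases h with h | h
        · refine ⟨(β, β + a), ?_, ⟨by simp only; linarith, by simp only; linarith⟩⟩
          exact Finset.mem_insert_of_mem (Finset.mem_union_left _ (Finset.mem_image_of_mem _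
            ((hB.finite c hc).mem_toFinset.2 ⟨hβ, by simp only [mem_Iic]; linarith⟩)))
        · refine ⟨(α, α + b), ?_, ⟨by simp only; linarith, by simp only; linarith⟩⟩
          exact Finset.mem_insert_of_mem (Finset.mem_union_right _ (Finset.mem_image_of_mem _
            ((hA.finite c hc).mem_toFinset.2 ⟨hα, by simp only [mem_Iic]; linarith⟩)))
      · exact ⟨(c, a + b), Finset.mem_insert_self _ _, h3, add_le_add h1 h2⟩
    · rintro ⟨p, hp, ht⟩
      simp only [F, Finset.mem_insert, Finset.mem_union, Finset.mem_image,
        Set.Finite.mem_toFinset] at hp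
      rcases hp with rfl | ⟨β, hβ, rfl⟩ | ⟨α, hα, rfl⟩
      · exact hcX ht
      · exact hA.add_Icc_subset hβ.1 ht
      · rw [sumNotBothNeg_comm]
        exact hB.add_Icc_subset hα.1 ht
  rw [hX]
  exact _root_.exists_isSegmentDecomposition F hF

end IsFriedrichsSpectrum

end SumOfSpectra

/-! ### Spectra of the concrete models and the main theorem -/

section Main

theorem realSpectrum_of_isEigenvalue {H : Type*} [NormedAddCommGroup H] [InnerProductSpace ℂ H]
    [CompleteSpace H] {A : H →L[ℂ] H} (hA : IsSelfAdjoint A) {t : ℝ} (ht : IsEigenvalue A t) :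
    t ∈ realSpectrum A := by
  obtain ⟨x, hx, hx0⟩ := Module.End.HasEigenvalue.exists_hasEigenvector ht
  refine (mem_realSpectrum_iff hA t).2 fun c hc => ⟨x, ?_⟩
  have h1 : A x - (t : ℂ) • x = 0 := sub_eq_zero.2 (Module.End.mem_eigenspace_iff.1 hx)
  rw [h1, norm_zero]
  exact mul_pos hc (norm_pos_iff.2 hx0)

theorem isCompact_realSpectrum {H : Type*} [NormedAddCommGroup H] [InnerProductSpace ℂ H]
    [CompleteSpace H] (A : H →L[ℂ] H) : IsCompact (realSpectrum A) :=
  Complex.isometry_ofReal.isClosedEmbedding.isCompact_preimage (spectrum.isCompact A)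

/-- The spectrum below `c < 0` is compact and all its points are isolated, hence it is finite.
Infinitely many discrete eigenvalues must then approach `0` from below, since no point of `(0, ‖u‖]`
is isolated. -/
theorem isFriedrichsSpectrum_realSpectrum {u : C(I, ℝ)} {k : C(I × I, ℂ)} (hu : ∀ x, 0 ≤ u x)
    (hu₀ : ∃ x, u x = 0) (hK : (integralOp k).IsPositive)
    (hd : (discreteSpectrum (friedrichs u k)).Infinite) :
    IsFriedrichsSpectrum (realSpectrum (friedrichs u k)) ‖u‖ := by
  have hrange := range_eq_Icc_norm hu hu₀
  have hIcc : Icc 0 ‖u‖ ⊆ realSpectrum (friedrichs u k) := by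
    rw [← hrange]
    rintro _ ⟨x, rfl⟩
    exact apply_mem_realSpectrum_friedrichs u hK x
  have hle : ∀ s ∈ realSpectrum (friedrichs u k), s ≤ ‖u‖ := fun s hs =>
    le_norm_of_mem_realSpectrum_friedrichs u hK hs
  have hfin : ∀ c < 0, (realSpectrum (friedrichs u k) ∩ Iic c).Finite := by
    intro c hc
    by_contra hinf
    obtain ⟨t, ⟨ht, htc⟩, hacc⟩ := Set.Infinite.exists_accPt_of_subset_isCompact hinf
      ((isCompact_realSpectrum _).inter_right isClosed_Iic) Subset.rfl
    obtain ⟨-, -, δ, hδ, hiso⟩ := mem_discreteSpectrum_friedrichs u hK ht (by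
      rw [hrange]
      exact fun h => absurd h.1 (not_le.2 (lt_of_le_of_lt htc hc)))
    rw [accPt_iff_frequently] at hacc
    obtain ⟨s, ⟨hne, hs⟩, hsd⟩ := (hacc.and_eventually (Metric.ball_mem_nhds t hδ)).exists
    exact hne (hiso s hs.1 hsd)
  refine ⟨norm_nonneg u, hIcc, hle, hfin, ?_⟩
  intro ε hε
  by_contra! hcon
  -- With a gap `(-ε, 0)` in the spectrum, the discrete spectrum would lie in the finite part below
  -- `-ε` together with `0`.
  refine hd (((hfin (-ε) (by linarith)).union (finite_singleton 0)).subset fun t ht => ?_)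
  have hts := realSpectrum_of_isEigenvalue (isSelfAdjoint_friedrichs u hK) ht.1
  rcases lt_or_ge (-ε) t with h1 | h1
  · right
    obtain ⟨-, -, δ, hδ, hiso⟩ := ht
    have h2 := hcon t hts h1
    by_contra hne
    have hpos : 0 < t := lt_of_le_of_ne h2 (Ne.symm hne)
    have hd1 : min (δ / 2) t ≤ δ / 2 := min_le_left _ _
    have hd2 : min (δ / 2) t ≤ t := min_le_right _ _
    have hd0 : 0 < min (δ / 2) t := by positivity
    have := hiso (t - min (δ / 2) t) (hIcc ⟨by linarith, by linarith [hle t hts]⟩)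
      (abs_lt.2 ⟨by linarith, by linarith⟩)
    linarith
  · exact Or.inl ⟨hts, h1⟩

/-- The essential spectrum of the three-particle operator. -/
theorem essentialSpectrum_opT {u v : C(I, ℝ)} {k₁ k₂ : C(I × I, ℂ)} (hu : ∀ x, 0 ≤ u x)
    (hv : ∀ x, 0 ≤ v x) (hK₁ : (integralOp k₁).IsPositive) (hK₂ : (integralOp k₂).IsPositive)
    {a b : ℝ} (h₁ : IsFriedrichsSpectrum (realSpectrum (friedrichs u k₁)) a)
    (h₂ : IsFriedrichsSpectrum (realSpectrum (friedrichs v k₂)) b) :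
    essentialSpectrum (opT u v k₁ k₂) =
      sumNotBothNeg (realSpectrum (friedrichs u k₁)) (realSpectrum (friedrichs v k₂)) := by
  refine Subset.antisymm
    (fun t ht => exists_add_eq_of_mem_essentialSpectrum_opT hu hv hK₁ hK₂ ht) fun t ht => ⟨?_, ?_⟩
  · obtain ⟨α, hα, β, hβ, rfl, -⟩ := ht
    exact add_mem_realSpectrum_opT hK₁ hK₂ hα hβ
  -- Failure of isolation alone excludes the discrete spectrum; multiplicities play no role.
  · rintro ⟨-, -, δ, hδ, hiso⟩
    obtain ⟨α, hα, β, hβ, hne, hlt⟩ := h₁.exists_add_ne_near h₂ ht hδ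
    exact hne (hiso _ (add_mem_realSpectrum_opT hK₁ hK₂ hα hβ) hlt)

theorem isEigenvalue_of_neg {u : C(I, ℝ)} {k : C(I × I, ℂ)} (hu : ∀ x, 0 ≤ u x)
    (hK : (integralOp k).IsPositive) {t : ℝ} (ht : t ∈ realSpectrum (friedrichs u k))
    (h0 : t < 0) : IsEigenvalue (friedrichs u k) t :=
  (mem_discreteSpectrum_friedrichs u hK ht fun ⟨x, hx⟩ =>
    absurd (hu x) (not_le.2 (hx.trans_lt h0))).1

theorem IsFriedrichsSpectrum.exists_seq {A : Set ℝ} {a : ℝ} (h : IsFriedrichsSpectrum A a) :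
    ∃ l : ℕ → ℝ, (∀ n, l n ∈ A ∧ l n < 0) ∧ Tendsto l atTop (𝓝 0) := by
  choose l hl h1 h2 using fun n : ℕ =>
    h.exists_neg (1 / ((n : ℝ) + 1)) (by positivity)
  refine ⟨l, fun n => ⟨hl n, h2 n⟩, squeeze_zero_norm (fun n => ?_)
    (tendsto_one_div_add_atTop_nhds_zero_nat (𝕜 := ℝ))⟩
  rw [Real.norm_eq_abs, abs_of_neg (h2 n)]
  linarith [h1 n]

end Main

end

theorem mainTheorem6 (u v : C(I, ℝ)) (k₁ k₂ : C(I × I, ℂ))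
    (hu : ∀ x, 0 ≤ u x) (hu₀ : ∃ x, u x = 0)
    (hv : ∀ x, 0 ≤ v x) (hv₀ : ∃ x, v x = 0)
    (huv : u ≠ 0 ∨ v ≠ 0)
    (hk₁ : ∀ x s, k₁ (x, s) = conj (k₁ (s, x)))
    (hk₂ : ∀ x s, k₂ (x, s) = conj (k₂ (s, x)))
    (hK₁ : (integralOp k₁).IsPositive) (hK₂ : (integralOp k₂).IsPositive)
    (hd₁ : (discreteSpectrum (friedrichs u k₁)).Infinite)
    (hd₂ : (discreteSpectrum (friedrichs v k₂)).Infinite) :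
    (∃ (n : ℕ) (S S' : Fin n → ℝ),
        IsSegmentDecomposition (essentialSpectrum (opT u v k₁ k₂)) n S S') ∧
      ∀ (n : ℕ) (S S' : Fin n → ℝ),
        IsSegmentDecomposition (essentialSpectrum (opT u v k₁ k₂)) n S S' →
          (∀ k, HasLeftEfimovEffect (opT u v k₁ k₂) (S k)) ∧
          (u ≠ 0 → v ≠ 0 → ∀ k, S k < S' k) := by
  have h₁ := isFriedrichsSpectrum_realSpectrum hu hu₀ hK₁ hd₁
  have h₂ := isFriedrichsSpectrum_realSpectrum hv hv₀ hK₂ hd₂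
  have hE := essentialSpectrum_opT hu hv hK₁ hK₂ h₁ h₂
  rw [hE]
  refine ⟨h₁.exists_isSegmentDecomposition h₂ (huv.imp norm_pos_iff.2 norm_pos_iff.2),
    fun n S S' hS => ⟨fun k => ?_, fun hu0 hv0 k => ?_⟩⟩
  · obtain ⟨δ, hδ, hiso⟩ := hS.exists_forall_dist_lt k
    refine ⟨hE ▸ hS.left_mem k, ⟨δ, hδ, ?_⟩, ?_⟩
    · rw [hE]
      refine Subset.antisymm (fun s hs => ?_) (singleton_subset_iff.2
        ⟨⟨by linarith, le_rfl⟩, hS.left_mem k⟩)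
      have h3 := hs.1.1
      have h4 := hs.1.2
      exact le_antisymm h4 (hiso s hs.2 (abs_lt.2 ⟨by linarith, by linarith⟩)).1
    · obtain ⟨hmem, hneg⟩ := h₁.left_endpoint h₂ (hS.left_mem k) hδ
        fun s hs hsd => (hiso s hs hsd).1
      -- Whichever model has `S k` as a negative eigenvalue, the negative eigenvalues of the other
      -- one, tending to `0`, are added to it.
      rcases hmem with hmem | hmem
      · obtain ⟨l, hl, hlim⟩ := h₂.exists_seq
        refine ⟨fun n => S k + l n, fun n => ⟨isEigenvalue_opT_add
          (isEigenvalue_of_neg hu hK₁ hmem hneg)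
          (isEigenvalue_of_neg hv hK₂ (hl n).1 (hl n).2), by linarith [(hl n).2]⟩, ?_⟩
        simpa using hlim.const_add (S k)
      · obtain ⟨l, hl, hlim⟩ := h₁.exists_seq
        refine ⟨fun n => l n + S k, fun n => ⟨isEigenvalue_opT_add
          (isEigenvalue_of_neg hu hK₁ (hl n).1 (hl n).2)
          (isEigenvalue_of_neg hv hK₂ hmem hneg), by linarith [(hl n).2]⟩, ?_⟩
        simpa using hlim.add_const (S k)
  -- A one-point segment would be an isolated point of the essential spectrum, which is impossible
  -- when both `‖u‖` and `‖v‖` are positive.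
  · refine lt_of_le_of_ne (hS.2.1 k) fun heq => ?_
    obtain ⟨δ, hδ, hiso⟩ := hS.exists_forall_dist_lt k
    obtain ⟨s, hs, hne, hsd⟩ := h₁.sumNotBothNeg_not_isolated h₂ (norm_pos_iff.2 hu0)
      (norm_pos_iff.2 hv0) (hS.left_mem k) hδ
    have h3 := hiso s hs hsd
    rw [← heq, Icc_self] at h3
    exact hne h3
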